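/- Let $\mathbb F=\mathbb F_q$ be a finite field with $q$ elements, $A=\mathbb F[T]$, and $K_\infty=\mathbb F((T^{-1}))$ with the absolute value normalized by $|T|=q$. Let $C$ be the completion of an algebraic closure of $K_\infty$, with the unique extension of $|\cdot|$, let $L\subset C$ be a finite extension of $K_\infty$, and let $r\ge 2$. A Drinfeld $A$-module $\phi$ of rank $r$ over $L$ is given by $\phi_T(X)=TX+g_1X^q+\dots+g_rX^{q^r}$ with $g_1,\dots,g_r\in L$ and $g_r\neq 0$; let $a\mapsto\phi_a$ be the induced $\mathbb F$-algebra homomorphism from $A$ to the $\mathbb F$-linear endomorphisms of $C$, and $\operatorname{tor}(\phi)=\bigcup_{0\ne a\in A}\ker(\phi_a)\subset C$. Its period lattice is the free $A$-submodule $\Lambda\subset C$ of rank $r$, with finitely many elements in each ball, such that $e_\Lambda(Tz)=\phi_T(e_\Lambda(z))$ for all $z\in C$, where $e_\Lambda(z)=z\prod_{0\neq\lambda\in\Lambda}(1-z/\lambda)$. For every Drinfeld $A$-module $\phi$ of rank $r$ over $L$ with period lattice $\Lambda$, the field $L(\Lambda)$ is a finite extension of $L$ and $L(\Lambda)=L(\operatorname{tor}(\phi))$.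 Moreover, $L(\Lambda)$ may have arbitrarily large ramification index over $L$: for every $N\in\mathbb N$ there is a Drinfeld $A$-module $\phi$ of rank $r$ over $L$ with period lattice $\Lambda$ such that the ramification index $e(L(\Lambda)|L)=[\,|L(\Lambda)^\times|:|L^\times|\,]$ is at least $N$, and in particular $[L(\Lambda):L]\ge N$. -/

import Mathlib

noncomputable section

namespace DrinfeldPeriods

open Polynomial

open scoped WithZero NNReal

section Fields

variable (F : Type*) [Field F]

/-- The field `K_∞ = F((T⁻¹))`: Laurent series over `F` whose variable is read as `T⁻¹`. This is a
`def`, so the Mathlib instance that lets a polynomial in `X` act on `F⸨X⸩` by `X` itself is not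
available on it. -/
def KInf : Type _ := LaurentSeries F

instance : Field (KInf F) := inferInstanceAs (Field (LaurentSeries F))

instance : Algebra F (KInf F) := inferInstanceAs (Algebra F (LaurentSeries F))

/-- The element `T` of `K_∞ = F((T⁻¹))`. -/
def KInf.T : KInf F := (HahnSeries.single (-1 : ℤ) (1 : F) : LaurentSeries F)

/-- `A = F[T]` acts on `K_∞` through the inclusion of `A` in `K_∞`. -/
instance : Algebra F[X] (KInf F) := (aeval (KInf.T F)).toAlgebra

theorem KInf.algebraMap_apply (a : F[X]) : algebraMap F[X] (KInf F) a = aeval (KInf.T F) a := rfl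

instance : IsScalarTower F F[X] (KInf F) :=
  IsScalarTower.of_algebraMap_eq fun x => by
    rw [KInf.algebraMap_apply, AlgHom.commutes]

/-- The valuation of `K_∞` at the place `∞`, written multiplicatively. -/
instance : Valued (KInf F) ℤᵐ⁰ := inferInstanceAs (Valued (LaurentSeries F) ℤᵐ⁰)

theorem KInf.valuation_surjective :
    Function.Surjective (Valued.v : Valuation (KInf F) ℤᵐ⁰) :=
  LaurentSeries.valuation_surjective F

theorem KInf.valuation_T : (Valued.v : Valuation (KInf F) ℤᵐ⁰) (KInf.T F) = WithZero.exp 1 :=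
  LaurentSeries.valuation_single_zpow F (-1)

instance : (Valued.v : Valuation (KInf F) ℤᵐ⁰).IsNontrivial where
  exists_val_nontrivial := ⟨KInf.T F, by rw [KInf.valuation_T]; decide⟩

instance : (Valued.v : Valuation (KInf F) ℤᵐ⁰).IsRankOneDiscrete :=
  Valuation.IsRankOneDiscrete.mk' _

variable [Fintype F]

theorem one_lt_card_nnreal : (1 : ℝ≥0) < Fintype.card F := by
  exact_mod_cast Fintype.one_lt_card

/-- The base `q` of the absolute value, so that `|T| = q`. -/
instance : (Valued.v : Valuation (KInf F) ℤᵐ⁰).RankOne :=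
  Valuation.IsRankOneDiscrete.rankOne _ (one_lt_card_nnreal F)

/-- `K_∞` with its absolute value, normalized by `|T| = q`. -/
instance : NontriviallyNormedField (KInf F) :=
  Valued.toNontriviallyNormedField (KInf F) ℤᵐ⁰

theorem KInf.norm_def (x : KInf F) :
    ‖x‖ = WithZeroMulInt.toNNReal (one_lt_card_nnreal F).ne_bot (Valued.v x) := by
  change ((WithZeroMulInt.toNNReal (one_lt_card_nnreal F).ne_bot
    (Valuation.IsRankOneDiscrete.valueGroup₀_equiv_withZeroMulInt Valued.v
      (Valued.v.restrict x)) : ℝ≥0) : ℝ) = _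
  rw [Valuation.IsRankOneDiscrete.valueGroup₀_equiv_withZeroMulInt_restrict_apply_of_surjective
      (KInf.valuation_surjective F)]

theorem KInf.norm_T : ‖KInf.T F‖ = Fintype.card F := by
  rw [KInf.norm_def, KInf.valuation_T, WithZeroMulInt.toNNReal_neg_apply _ (by simp)]
  simp [WithZero.exp]

instance : CompleteSpace (KInf F) := inferInstanceAs (CompleteSpace (LaurentSeries F))

instance : IsUltrametricDist (KInf F) := inferInstance

/-- A fixed algebraic closure of `K_∞`. -/
abbrev KInfAlgCl : Type _ := AlgebraicClosure (KInf F)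

/-- The absolute value of the algebraic closure of `K_∞` is the unique extension of that of `K_∞`,
which is the spectral norm. -/
instance : NontriviallyNormedField (KInfAlgCl F) :=
  spectralNorm.nontriviallyNormedField (KInf F) (KInfAlgCl F)

instance : NormedAlgebra (KInf F) (KInfAlgCl F) := spectralNorm.normedAlgebra _ _

instance : IsUltrametricDist (KInfAlgCl F) :=
  IsUltrametricDist.isUltrametricDist_of_forall_norm_add_le_max_norm
    (isNonarchimedean_spectralNorm (K := KInf F) (L := KInfAlgCl F))

/-- The field `C`, the completed algebraic closure of `K_∞`. -/
abbrev CInf : Type _ := UniformSpace.Completion (KInfAlgCl F)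

instance : UniformContinuousConstSMul (KInf F) (KInfAlgCl F) :=
  uniformContinuousConstSMul_of_continuousConstSMul _ _

instance {R : Type*} [CommSemiring R] [Algebra R (KInf F)] :
    UniformContinuousConstSMul R (KInfAlgCl F) where
  uniformContinuous_const_smul a := by
    simp_rw [← algebraMap_smul (KInf F) a]
    exact uniformContinuous_const_smul (algebraMap R (KInf F) a)
instance : IsScalarTower (KInf F) (KInfAlgCl F) (CInf F) :=
  IsScalarTower.of_algebraMap_eq (congrFun rfl)

instance : IsScalarTower F (KInf F) (CInf F) := IsScalarTower.of_algebraMap_eq (congrFun rfl)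

instance : IsScalarTower F[X] (KInf F) (CInf F) := IsScalarTower.of_algebraMap_eq (congrFun rfl)

instance : IsScalarTower F F[X] (CInf F) := IsScalarTower.of_algebraMap_eq fun x => by
  rw [IsScalarTower.algebraMap_apply F (KInf F) (CInf F),
    IsScalarTower.algebraMap_apply F F[X] (KInf F),
    ← IsScalarTower.algebraMap_apply F[X] (KInf F) (CInf F)]

instance : IsUltrametricDist (CInf F) := IsUltrametricDist.of_normedAlgebra (KInf F)

instance : NontriviallyNormedField (CInf F) where
  non_trivial := by
    obtain ⟨x, hx⟩ := NontriviallyNormedField.non_trivial (α := KInf F)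
    exact ⟨algebraMap (KInf F) (CInf F) x, by rwa [norm_algebraMap']⟩

/-- The element `T` of `C`. -/
def CInf.T : CInf F := algebraMap (KInf F) (CInf F) (KInf.T F)

theorem CInf.X_smul (z : CInf F) : (X : F[X]) • z = CInf.T F * z := by
  rw [← algebraMap_smul (KInf F) (X : F[X]) z, KInf.algebraMap_apply, aeval_X, Algebra.smul_def,
    CInf.T]

theorem CInf.norm_T : ‖CInf.T F‖ = Fintype.card F := by
  rw [CInf.T, norm_algebraMap', KInf.norm_T]

end Fields

section DrinfeldModules

variable {F : Type*} [Field F] [Fintype F]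

/-- A Drinfeld `F[T]`-module of rank `r` over a field `L` between `K_∞` and `C`, given by the
coefficients `g_0 = T, g_1, …, g_r ∈ L` with `g_r ≠ 0` of its operator polynomial
`φ_T(X) = T X + g_1 X^q + ⋯ + g_r X^(q^r)`, where `q` is the cardinality of `F`. -/
structure DrinfeldModule (L : IntermediateField (KInf F) (CInf F)) (r : ℕ) where
  /-- The coefficients `g_0, …, g_r`. -/
  coeff : Fin (r + 1) → L
  coeff_zero : coeff 0 = algebraMap (KInf F) L (KInf.T F)
  coeff_last : coeff (Fin.last r) ≠ 0

namespace DrinfeldModule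

variable {L : IntermediateField (KInf F) (CInf F)} {r : ℕ} (φ : DrinfeldModule L r)

/-- The `F`-linear operator `z ↦ φ_T(z)` on `C`. -/
def opT : Module.End F (CInf F) where
  toFun z := ∑ i : Fin (r + 1), (φ.coeff i : CInf F) * z ^ Fintype.card F ^ (i : ℕ)
  map_add' x y := by
    have h (n : ℕ) (z : CInf F) :
        z ^ Fintype.card F ^ n = (FiniteField.frobeniusAlgHom F (CInf F) ^ n) z := by
      simp [AlgHom.coe_pow, FiniteField.coe_frobeniusAlgHom, pow_iterate]
    simp only [h, map_add, mul_add, Finset.sum_add_distrib]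
  map_smul' c x := by
    simp [_root_.smul_pow, FiniteField.pow_card_pow, Finset.smul_sum]

/-- The action `a ↦ φ_a` of `F[T]` on `C`: the `F`-algebra homomorphism that sends `T` to `φ_T`. -/
def op : F[X] →ₐ[F] Module.End F (CInf F) := aeval φ.opT

/-- The set `φ[a]` of `a`-division points. -/
def divisionPoints (a : F[X]) : Set (CInf F) := {z | φ.op a z = 0}

/-- The torsion `tor(φ)`, the union of all `φ[a]` with `a ≠ 0`. -/
def tor : Set (CInf F) := ⋃ (a : F[X]) (_ : a ≠ 0), φ.divisionPoints a

end DrinfeldModule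

/-- An `F[T]`-lattice of rank `r` in `C`: a free `F[T]`-submodule of rank `r` that is discrete, in
the sense that it has only finitely many elements in each ball. -/
structure IsLattice (r : ℕ) (Λ : Submodule F[X] (CInf F)) : Prop where
  free : Module.Free F[X] Λ
  finite : Module.Finite F[X] Λ
  finrank_eq : Module.finrank F[X] Λ = r
  discrete : ∀ R : ℝ, {l : CInf F | l ∈ Λ ∧ ‖l‖ ≤ R}.Finite

/-- The exponential function `e_Λ(z) = z ∏ (1 - z / λ)`, the product being over the nonzero
elements `λ` of `Λ`. It converges for every lattice. -/
def latticeExp (Λ : Submodule F[X] (CInf F)) (z : CInf F) : CInf F :=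
  z * ∏' l : {l : CInf F // l ∈ Λ ∧ l ≠ 0}, (1 - z / (l : CInf F))

/-- `Λ` is the period lattice of the Drinfeld module `φ` of rank `r`: it is a lattice of rank `r`
and `e_Λ(T z) = φ_T(e_Λ(z))` for all `z ∈ C`. -/
structure IsPeriodLattice {L : IntermediateField (KInf F) (CInf F)} {r : ℕ}
    (φ : DrinfeldModule L r) (Λ : Submodule F[X] (CInf F)) : Prop where
  isLattice : IsLattice r Λ
  latticeExp_T_mul : ∀ z : CInf F, latticeExp Λ (CInf.T F * z) = φ.opT (latticeExp Λ z)

/-- The value group `|M^×|` of a subfield `M` of `C`. -/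
def valueGroup (M : Subfield (CInf F)) : Subgroup ℝˣ :=
  (Units.map (((normHom : CInf F →*₀ ℝ) : CInf F →* ℝ).comp (M.subtype : M →* CInf F))).range

/-- The ramification index `e(M | E)` of subfields `E ⊆ M` of `C`, which is the index of the value
group of `E` in that of `M` (with the value `0` if that index is infinite). -/
def ramificationIndex (E M : Subfield (CInf F)) : ℕ :=
  (valueGroup E).relIndex (valueGroup M)

end DrinfeldModules

end DrinfeldPeriods

end

open DrinfeldPeriods

/-!
The exponential function `e_V` of a strongly discrete `F`-subspace `V` of `C` is a limit of
`F`-linear polynomials with derivative `1` at `0`. For a period `λ` the points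
`y_n = e_Λ(λ / T^n)` are torsion points tending to `0` with `φ_T(y_{n+1}) = y_n`. As `φ_T` is
invertible near `0` by successive approximation, `y_n` lies in the complete field `L(y_{n₀})` for
all `n ≥ n₀`, for a suitable `n₀`, and hence so does `λ = lim T^n y_n`. Conversely, torsion points
are values of `e_Λ` at points of `L(Λ)`, which is finite over `L` and therefore complete.

For large ramification let `m = n q^n + 1` and let `ω` be a root of
`∏_{deg a < n} (X - a) = T^m`. The conjugates of `ω` over `L` are among its translates `ω + a`, so
the lattice `A + Aω + ⋯ + Aω^{r-1}` is stable under `Gal(L(ω)/L)` and belongs to a Drinfeld module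
over `L`. Since `|ω|^{q^n} = q^m` with `m` prime to `q`, the ramification grows with `n`.
-/

noncomputable section

namespace DrinfeldPeriods

open Polynomial Filter Topology

section LinearizedPolynomials

section CommRing

variable {q : ℕ} {R : Type*} [CommRing R]

variable (q R) in
/-- The linearized polynomials (`q`-polynomials) over `R`: the `R`-linear combinations of the
monomials `X ^ q ^ i`. If `q` is the cardinality of a finite field `F`, they induce `F`-linear
maps. -/
def linearized : Submodule R R[X] :=
  Submodule.span R (Set.range fun i : ℕ => X ^ q ^ i)

theorem X_mem_linearized : X ∈ linearized q R :=
  Submodule.subset_span ⟨0, by simp⟩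

theorem exists_eq_pow_of_mem_support_of_mem_linearized {p : R[X]} (hp : p ∈ linearized q R)
    {n : ℕ} (hn : n ∈ p.support) : ∃ i, n = q ^ i := by
  contrapose! hn
  rw [notMem_support_iff]
  induction hp using Submodule.span_induction with
  | mem p hp =>
    obtain ⟨i, rfl⟩ := hp
    simp [coeff_X_pow, hn i]
  | zero => simp
  | add p p' _ _ ih ih' => simp [ih, ih']
  | smul c p _ ih => simp [ih]

theorem eq_sum_of_mem_linearized (hq : 1 < q) {p : R[X]}
    (hp : p ∈ linearized q R) {k : ℕ} (hk : p.natDegree ≤ q ^ k) :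
    p = ∑ i ∈ Finset.range (k + 1), C (p.coeff (q ^ i)) * X ^ q ^ i := by
  have hinj : Function.Injective fun i : ℕ => q ^ i := Nat.pow_right_injective hq
  have hsupp : p.support ⊆ (Finset.range (k + 1)).image (q ^ ·) := fun n hn => by
    obtain ⟨i, rfl⟩ := exists_eq_pow_of_mem_support_of_mem_linearized hp hn
    have hi : i ≤ k := (Nat.pow_le_pow_iff_right hq).1 ((le_natDegree_of_mem_supp _ hn).trans hk)
    exact Finset.mem_image_of_mem _ (Finset.mem_range_succ_iff.2 hi)
  conv_lhs => rw [as_sum_support_C_mul_X_pow p]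
  rw [Finset.sum_subset hsupp fun n _ hn => by simp [notMem_support_iff.1 hn],
    Finset.sum_image hinj.injOn]

variable {F : Type*} [Field F] [Fintype F] [Algebra F R]

theorem pow_card_mem_linearized {p : R[X]} (hp : p ∈ linearized (Fintype.card F) R) :
    p ^ Fintype.card F ∈ linearized (Fintype.card F) R := by
  induction hp using Submodule.span_induction with
  | mem p hp =>
    obtain ⟨i, rfl⟩ := hp
    exact Submodule.subset_span ⟨i + 1, by simp only [← pow_mul, pow_succ]⟩
  | zero => simp [zero_pow Fintype.card_ne_zero]
  | add p p' _ _ ih ih' =>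
    rw [← FiniteField.frobeniusAlgHom_apply F, map_add]
    exact add_mem ih ih'
  | smul c p _ ih =>
    rw [_root_.smul_pow]
    exact Submodule.smul_mem _ _ ih

theorem exists_linearMap_eq_aeval_of_mem_linearized {p : R[X]}
    (hp : p ∈ linearized (Fintype.card F) R)
    (B : Type*) [CommRing B] [Algebra F B] [Algebra R B] [IsScalarTower F R B] :
    ∃ f : B →ₗ[F] B, ∀ x, f x = aeval x p := by
  induction hp using Submodule.span_induction with
  | mem p hp =>
    obtain ⟨i, rfl⟩ := hp
    refine ⟨(FiniteField.frobeniusAlgHom F B ^ i).toLinearMap, fun x => ?_⟩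
    simp [AlgHom.coe_pow, FiniteField.coe_frobeniusAlgHom, pow_iterate]
  | zero => exact ⟨0, by simp⟩
  | add p p' _ _ ih ih' =>
    obtain ⟨⟨f, hf⟩, f', hf'⟩ := ih, ih'
    exact ⟨f + f', fun x => by simp [hf, hf']⟩
  | smul c p _ ih =>
    obtain ⟨f, hf⟩ := ih
    exact ⟨LinearMap.mulLeft F (algebraMap R B c) ∘ₗ f, fun x => by
      simp [hf, Algebra.smul_def]⟩

end CommRing

variable {F : Type*} [Field F] [Fintype F] {E : Type*} [Field E] [Algebra F E]

variable (F) in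
theorem prod_X_sub_C_eq_X_pow_card_sub_X :
    ∏ c : F, (X - C c) = (X ^ Fintype.card F - X : F[X]) := by
  have hm : (X ^ Fintype.card F - X : F[X]).Monic :=
    monic_X_pow_sub (by rw [degree_X]; exact_mod_cast Fintype.one_lt_card)
  have h := prod_multiset_X_sub_C_of_monic_of_roots_card_eq hm (by
    rw [FiniteField.roots_X_pow_card_sub_X,
      FiniteField.X_pow_card_sub_X_natDegree_eq F Fintype.one_lt_card]
    rfl)
  rwa [FiniteField.roots_X_pow_card_sub_X] at h

theorem prod_sub_C_smul (Y : E[X]) (z : E) :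
    ∏ c : F, (Y - C (c • z)) = Y ^ Fintype.card F - C (z ^ (Fintype.card F - 1)) * Y := by
  have hq : Fintype.card F - 1 ≠ 0 := Nat.sub_ne_zero_of_lt Fintype.one_lt_card
  rcases eq_or_ne z 0 with rfl | hz
  · simp [hq, Finset.card_univ]
  obtain ⟨W, rfl⟩ : ∃ W : E[X], Y = C z * W :=
    ⟨C z⁻¹ * Y, by rw [← mul_assoc, ← C_mul, mul_inv_cancel₀ hz, C_1, one_mul]⟩
  have hW : ∏ c : F, (W - C (algebraMap F E c)) = W ^ Fintype.card F - W := by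
    have := congrArg (aeval W) (prod_X_sub_C_eq_X_pow_card_sub_X F)
    simpa [map_prod, Polynomial.algebraMap_apply] using this
  have hfactor (c : F) : C z * W - C (c • z) = C z * (W - C (algebraMap F E c)) := by
    rw [mul_sub, ← C_mul, Algebra.smul_def, mul_comm z]
  simp_rw [hfactor]
  rw [Finset.prod_mul_distrib, hW, Finset.prod_const, Finset.card_univ, C_pow, ← mul_assoc,
    ← pow_succ, Nat.sub_add_cancel Fintype.card_pos, mul_pow, mul_sub]

theorem prod_X_sub_C_sum_smul_mem_linearized {k : ℕ} (v : Fin k → E) :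
    ∏ a : Fin k → F, (X - C (∑ i, a i • v i)) ∈ linearized (Fintype.card F) E := by
  induction k with
  | zero => simpa using X_mem_linearized (R := E)
  | succ k ih =>
    set P : E[X] := ∏ a : Fin k → F, (X - C (∑ i, a i • v i.succ)) with hP
    have hmem : P ∈ linearized (Fintype.card F) E := ih fun i => v i.succ
    have htranslate (c : F) : P.comp (X - C (c • v 0)) = P - C (c • P.eval (v 0)) := by
      obtain ⟨f, hf⟩ := exists_linearMap_eq_aeval_of_mem_linearized hmem E[X]
      have hcomp (Q : E[X]) : P.comp Q = f Q := by rw [hf]; rfl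
      have hC (z : E) : f (C z) = C (P.eval z) := by rw [← hcomp, comp_C]
      rw [hcomp, map_sub, ← hcomp X, comp_X, ← smul_C, map_smul, hC, smul_C]
    have hprod : ∏ a : Fin (k + 1) → F, (X - C (∑ i, a i • v i)) =
        P ^ Fintype.card F - C (P.eval (v 0) ^ (Fintype.card F - 1)) * P := by
      rw [← prod_sub_C_smul, ← (Fin.consEquiv fun _ => F).prod_comp, Fintype.prod_prod_type]
      refine Finset.prod_congr rfl fun c _ => ?_
      rw [← htranslate, hP, prod_comp]
      exact Finset.prod_congr rfl fun a _ => by simp [Fin.consEquiv, Fin.sum_univ_succ, sub_sub]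
    rw [hprod, ← smul_eq_C_mul]
    exact sub_mem (pow_card_mem_linearized hmem) (Submodule.smul_mem _ _ hmem)

theorem prod_X_sub_C_mem_linearized (U : Submodule F E) [Fintype U] :
    ∏ u : U, (X - C (u : E)) ∈ linearized (Fintype.card F) E := by
  have : Module.Finite F U := Module.Finite.of_finite
  let b := Module.finBasis F U
  have h : ∏ u : U, (X - C (u : E)) =
      ∏ a : Fin (Module.finrank F U) → F, (X - C (∑ i, a i • (b i : E))) := by
    rw [← b.equivFun.symm.toEquiv.prod_comp]
    exact Finset.prod_congr rfl fun a _ => by simp [b.equivFun_symm_apply]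
  exact h ▸ prod_X_sub_C_sum_smul_mem_linearized _

end LinearizedPolynomials

section InfiniteProducts

variable {ι E : Type*} [NormedField E]

theorem norm_prod_le_prod_max_one (f : ι → E) {s t : Finset ι} (h : ∀ i ∉ t, ‖f i‖ ≤ 1) :
    ‖∏ i ∈ s, f i‖ ≤ ∏ i ∈ t, max 1 ‖f i‖ := by
  classical
  calc ‖∏ i ∈ s, f i‖ = ∏ i ∈ s, ‖f i‖ := norm_prod _ _
    _ ≤ ∏ i ∈ s, max 1 ‖f i‖ :=
        Finset.prod_le_prod (fun _ _ => norm_nonneg _) fun _ _ => le_max_right _ _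
    _ ≤ ∏ i ∈ s ∪ t, max 1 ‖f i‖ :=
        Finset.prod_mono_set_of_one_le (fun _ => le_max_left _ _) Finset.subset_union_left
    _ = ∏ i ∈ t, max 1 ‖f i‖ :=
        (Finset.prod_subset Finset.subset_union_right fun i _ hi => max_eq_left (h i hi)).symm

theorem tendsto_prod_cofinite_zero {f : ι → E} (hf : Tendsto f cofinite (𝓝 0)) :
    Tendsto (fun s : Finset ι => ∏ i ∈ s, f i) cofinite (𝓝 0) := by
  classical
  have hfin {ε : ℝ} (hε : 0 < ε) : {i | ε ≤ ‖f i‖}.Finite := by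
    simpa [eventually_cofinite] using Metric.tendsto_nhds.1 hf ε hε
  set B := ∏ i ∈ (hfin one_pos).toFinset, max 1 ‖f i‖
  have hB : 0 < B := Finset.prod_pos fun _ _ => lt_max_of_lt_left one_pos
  have hbound (s : Finset ι) : ‖∏ i ∈ s, f i‖ ≤ B :=
    norm_prod_le_prod_max_one f fun i hi => (by simpa using hi : ‖f i‖ < 1).le
  refine Metric.tendsto_nhds.2 fun ε hε => eventually_cofinite.2 ?_
  refine (hfin (div_pos hε hB)).toFinset.powerset.finite_toSet.subset fun s hs => ?_
  simp only [Finset.coe_powerset, Set.mem_preimage, Set.mem_powerset_iff, Set.Finite.coe_toFinset]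
  intro i hi
  by_contra! hlt
  refine hs ?_
  rw [dist_zero_right, ← Finset.mul_prod_erase s f hi, norm_mul]
  calc ‖f i‖ * ‖∏ j ∈ s.erase i, f j‖ ≤ ‖f i‖ * B :=
        mul_le_mul_of_nonneg_left (hbound _) (norm_nonneg _)
    _ < ε / B * B := mul_lt_mul_of_pos_right (not_le.1 hlt) hB
    _ = ε := div_mul_cancel₀ _ hB.ne'

variable [IsUltrametricDist E]

theorem norm_prod_one_add_sub_one_le (s : Finset ι) {f : ι → E} {δ : ℝ} (hδ : 0 ≤ δ)
    (hδ1 : δ ≤ 1) (hf : ∀ i, ‖f i‖ ≤ δ) : ‖∏ i ∈ s, (1 + f i) - 1‖ ≤ δ := by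
  classical
  induction s using Finset.induction_on with
  | empty => simpa
  | insert a s ha ih =>
    rw [Finset.prod_insert ha, show (1 + f a) * ∏ i ∈ s, (1 + f i) - 1 =
      (∏ i ∈ s, (1 + f i) - 1) + f a * (1 + (∏ i ∈ s, (1 + f i) - 1)) by ring]
    refine (IsUltrametricDist.norm_add_le_max _ _).trans (max_le ih ?_)
    rw [norm_mul]
    refine (mul_le_mul (hf a) ?_ (norm_nonneg _) hδ).trans_eq (mul_one δ)
    exact (IsUltrametricDist.norm_add_le_max _ _).trans (max_le norm_one.le (ih.trans hδ1))

variable [CompleteSpace E] {f : ι → E} (hf : Tendsto f cofinite (𝓝 0))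
include hf

theorem multipliable_one_add_of_tendsto_cofinite : Multipliable fun i => 1 + f i :=
  multipliable_one_add_of_summable_prod
    (NonarchimedeanAddGroup.summable_of_tendsto_cofinite_zero (tendsto_prod_cofinite_zero hf))

theorem norm_tprod_one_add_sub_one_le {δ : ℝ} (hδ : 0 ≤ δ) (hδ1 : δ ≤ 1) (hfδ : ∀ i, ‖f i‖ ≤ δ) :
    ‖∏' i, (1 + f i) - 1‖ ≤ δ :=
  le_of_tendsto ((multipliable_one_add_of_tendsto_cofinite hf).hasProd.sub_const 1).norm
    (Eventually.of_forall fun s => norm_prod_one_add_sub_one_le s hδ hδ1 hfδ)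

theorem tprod_one_add_ne_zero (h0 : ∀ i, 1 + f i ≠ 0) : ∏' i, (1 + f i) ≠ 0 := by
  -- The factors `(1 + f i)⁻¹ = 1 + g i` have the same form, and the two products are inverse.
  set g : ι → E := fun i => -f i / (1 + f i)
  have hg : Tendsto g cofinite (𝓝 0) := by
    simpa [g, Pi.div_def] using hf.neg.div (tendsto_const_nhds.add hf) (by simp)
  have hfg (i : ι) : (1 + f i) * (1 + g i) = 1 := by
    have := h0 i
    simp only [g]
    field_simp
    ring
  refine left_ne_zero_of_mul_eq_one (b := ∏' i, (1 + g i)) ?_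
  rw [← (multipliable_one_add_of_tendsto_cofinite hf).tprod_mul
    (multipliable_one_add_of_tendsto_cofinite hg)]
  simp [hfg]

end InfiniteProducts

section StronglyDiscrete

variable {F : Type*} [Field F] {E : Type*} [NormedField E] [Algebra F E]

/-- A subspace is strongly discrete if each ball contains only finitely many of its elements. -/
def StronglyDiscrete (V : Submodule F E) : Prop :=
  Tendsto (Subtype.val : V → E) cofinite (Bornology.cobounded E)

theorem stronglyDiscrete_iff {V : Submodule F E} :
    StronglyDiscrete V ↔ ∀ R : ℝ, {v : E | v ∈ V ∧ ‖v‖ ≤ R}.Finite := by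
  have himage (R : ℝ) : {v : E | v ∈ V ∧ ‖v‖ ≤ R} = Subtype.val '' {v : V | ‖(v : E)‖ ≤ R} := by
    ext v
    simp [and_comm]
  simp [StronglyDiscrete, (Metric.hasBasis_cobounded_compl_closedBall (0 : E)).tendsto_right_iff,
    himage, Set.finite_image_iff Subtype.val_injective.injOn]

theorem stronglyDiscrete_of_finite (V : Submodule F E) [Finite V] : StronglyDiscrete V := by
  simp [StronglyDiscrete]

theorem StronglyDiscrete.tendsto_div {V : Submodule F E} (hV : StronglyDiscrete V) (z : E) :
    Tendsto (fun v : V => z / (v : E)) cofinite (𝓝 0) := by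
  simpa [div_eq_mul_inv] using (tendsto_inv₀_cobounded.comp hV).const_mul z

theorem StronglyDiscrete.comap_mulLeft {V : Submodule F E} (hV : StronglyDiscrete V) {c : E}
    (hc : c ≠ 0) : StronglyDiscrete (V.comap (LinearMap.mulLeft F c)) := by
  rw [stronglyDiscrete_iff] at hV ⊢
  refine fun R => ((hV (‖c‖ * R)).preimage (mul_right_injective₀ hc).injOn).subset fun v hv => ?_
  exact ⟨hv.1, by simpa using mul_le_mul_of_nonneg_left hv.2 (norm_nonneg c)⟩

/-- The exponential function `e_V(z) = z ∏ (1 - z / v)` of a subspace `V`. The product may run over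
all `v ∈ V` because `z / 0 = 0`. -/
def subspaceExp (V : Submodule F E) (z : E) : E := z * ∏' v : V, (1 - z / (v : E))

theorem subspaceExp_comap_mulLeft (V : Submodule F E) {c : E} (hc : c ≠ 0) (z : E) :
    subspaceExp (V.comap (LinearMap.mulLeft F c)) z = c⁻¹ * subspaceExp V (c * z) := by
  let e : V.comap (LinearMap.mulLeft F c) ≃ V :=
    (Equiv.mulLeft₀ c hc).subtypeEquiv fun v => by simp
  rw [subspaceExp, subspaceExp, ← e.tprod_eq, mul_assoc, inv_mul_cancel_left₀ hc]
  congr 2 with v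
  rw [show (e v : E) = c * v from rfl, mul_div_mul_left _ _ hc]

theorem map_subspaceExp {E' : Type*} [NormedField E'] [Algebra F E'] (f : E →ₐ[F] E')
    (hf : Continuous f) (V : Submodule F E) {z : E}
    (h : Multipliable fun v : V => 1 - z / (v : E)) :
    f (subspaceExp V z) = subspaceExp (V.map f.toLinearMap) (f z) := by
  let e := (V.equivMapOfInjective f.toLinearMap f.injective).toEquiv
  rw [subspaceExp, subspaceExp, map_mul, h.map_tprod f hf, ← e.tprod_eq]
  congr 2 with v
  rw [map_sub, map_one, map_div₀]
  rfl

theorem exists_subspaceExp_eq_mul_eval_prod_X_sub_C (V : Submodule F E) [Fintype V] :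
    ∃ a, ∀ z, subspaceExp V z = a * (∏ v : V, (X - C (v : E))).eval z := by
  classical
  set c : V → E := fun v => if v = 0 then 1 else (-v : E)⁻¹ with hc
  refine ⟨∏ v, c v, fun z => ?_⟩
  have hfactor (v : V) (hv : v ≠ 0) : 1 - z / (v : E) = c v * (z - v) := by
    have : (v : E) ≠ 0 := by simpa using hv
    simp only [hc, if_neg hv]
    field_simp
    ring
  rw [subspaceExp, tprod_fintype, eval_prod, ← Finset.prod_mul_distrib,
    ← Finset.mul_prod_erase _ _ (Finset.mem_univ (0 : V)),
    ← Finset.mul_prod_erase _ (fun v : V => c v * eval z (X - C (v : E))) (Finset.mem_univ 0),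
    Finset.prod_congr rfl fun v hv => hfactor v (Finset.ne_of_mem_erase hv)]
  simp [hc]

theorem exists_linearized_eq_subspaceExp [Fintype F] (V : Submodule F E) [Finite V] :
    ∃ p ∈ linearized (Fintype.card F) E, ∀ z, subspaceExp V z = p.eval z := by
  cases nonempty_fintype V
  obtain ⟨a, hV⟩ := exists_subspaceExp_eq_mul_eval_prod_X_sub_C V
  exact ⟨_, Submodule.smul_mem _ a (prod_X_sub_C_mem_linearized V), fun z => by
    rw [hV, eval_smul, smul_eq_mul]⟩

end StronglyDiscrete

section SubspaceExp

namespace StronglyDiscrete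

variable {F : Type*} [Field F]
  {E : Type*} [NormedField E] [IsUltrametricDist E] [CompleteSpace E] [Algebra F E]
  {V : Submodule F E} (hV : StronglyDiscrete V)

include hV

theorem multipliable_one_sub_div (z : E) : Multipliable fun v : V => 1 - z / (v : E) := by
  simp_rw [sub_eq_add_neg]
  exact multipliable_one_add_of_tendsto_cofinite (by simpa using (hV.tendsto_div z).neg)

theorem subspaceExp_eq_zero_iff (z : E) : subspaceExp V z = 0 ↔ z ∈ V := by
  refine ⟨fun h => ?_, fun hz => ?_⟩
  · contrapose! h
    refine mul_ne_zero (fun h0 => h (h0 ▸ V.zero_mem)) ?_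
    simp_rw [sub_eq_add_neg]
    refine tprod_one_add_ne_zero (by simpa using (hV.tendsto_div z).neg) fun v hv => h ?_
    rw [← sub_eq_add_neg, sub_eq_zero, eq_comm] at hv
    rw [eq_of_div_eq_one hv]
    exact v.2
  · rcases eq_or_ne z 0 with rfl | h0
    · simp [subspaceExp]
    · rw [subspaceExp, tprod_of_exists_eq_zero ⟨⟨z, hz⟩, by simp [h0]⟩, mul_zero]

open Classical in
/-- The factor of `e_V` that vanishes at `0` is put into the product. -/
theorem hasProd_subspaceExp (z : E) :
    HasProd (fun v : V => if v = 0 then z else 1 - z / (v : E)) (subspaceExp V z) := by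
  refine ((hasProd_ite_eq 0 z).mul (hV.multipliable_one_sub_div z).hasProd).congr_fun fun v => ?_
  split_ifs with hv <;> simp [hv]

theorem tendsto_tprod_one_sub_div :
    Tendsto (fun z : E => ∏' v : V, (1 - z / (v : E))) (𝓝 0) (𝓝 1) := by
  obtain ⟨B, hB⟩ := (hV.tendsto_div 1).norm.bddAbove_range_of_cofinite
  have hbound (z : E) (v : V) : ‖-(z / (v : E))‖ ≤ ‖z‖ * B := by
    rw [norm_neg, ← mul_one_div, norm_mul]
    exact mul_le_mul_of_nonneg_left (hB ⟨v, rfl⟩) (norm_nonneg z)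
  have hB0 : 0 ≤ B := (norm_nonneg _).trans (hB ⟨0, rfl⟩)
  have hlim : Tendsto (fun z : E => ‖z‖ * B) (𝓝 0) (𝓝 0) := by
    simpa using (tendsto_norm_zero (E := E)).mul_const B
  refine tendsto_iff_norm_sub_tendsto_zero.2 (squeeze_zero' (.of_forall fun _ => norm_nonneg _)
    ?_ hlim)
  filter_upwards [hlim.eventually_le_const one_pos] with z hz
  simp_rw [sub_eq_add_neg (1 : E)]
  exact norm_tprod_one_add_sub_one_le (by simpa using (hV.tendsto_div z).neg) (by positivity) hz
    (hbound z)

end StronglyDiscrete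

theorem finite_span_finset {F M : Type*} [Field F] [Finite F] [AddCommGroup M] [Module F M]
    (s : Finset M) : Finite (Submodule.span F (s : Set M)) := by
  have := FiniteDimensional.span_finset F s
  exact Module.finite_of_finite F

theorem hasDerivAt_subspaceExp {F : Type*} [Field F] {E : Type*} [NontriviallyNormedField E]
    [IsUltrametricDist E] [CompleteSpace E] [Algebra F E] {V : Submodule F E}
    (hV : StronglyDiscrete V) : HasDerivAt (subspaceExp V) 1 0 := by
  rw [hasDerivAt_iff_tendsto_slope_zero]
  refine (hV.tendsto_tprod_one_sub_div.mono_left nhdsWithin_le_nhds).congr' ?_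
  filter_upwards [self_mem_nhdsWithin] with z hz
  rw [zero_add, subspaceExp, subspaceExp, zero_mul, sub_zero, smul_eq_mul, inv_mul_cancel_left₀ hz]

theorem isLinearMap_subspaceExp_of_finite {F E : Type*} [Field F] [Finite F] [NormedField E]
    [Algebra F E] (V : Submodule F E) [Finite V] : IsLinearMap F (subspaceExp V) := by
  cases nonempty_fintype F
  obtain ⟨p, hp, hpV⟩ := exists_linearized_eq_subspaceExp V
  obtain ⟨f, hf⟩ := exists_linearMap_eq_aeval_of_mem_linearized hp E
  have : subspaceExp V = f := funext fun z => by rw [hpV, hf, coe_aeval_eq_eval]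
  exact this ▸ f.isLinear

namespace StronglyDiscrete

variable {F : Type*} [Field F] [Finite F]
  {E : Type*} [NormedField E] [IsUltrametricDist E] [CompleteSpace E] [Algebra F E]
  {V W : Submodule F E}

open Submodule in
theorem tendsto_subspaceExp_span (hV : StronglyDiscrete V) (z : E) :
    Tendsto (fun s : Finset V => subspaceExp ((span F (s : Set V)).map V.subtype) z) atTop
      (𝓝 (subspaceExp V z)) := by
  have hfin (s : Finset V) := finite_span_finset (F := F) s
  let t (s : Finset V) : Finset V := (Set.toFinite (span F (s : Set V) : Set V)).toFinset
  have ht : Tendsto t atTop atTop :=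
    tendsto_atTop_mono (fun s v hv => by simpa [t] using subset_span hv) tendsto_id
  refine (((hV.multipliable_one_sub_div z).hasProd.comp ht).const_mul z).congr fun s => ?_
  let e := (span F (s : Set V)).equivMapOfInjective V.subtype V.injective_subtype
  have := Fintype.ofFinite (span F (s : Set V))
  rw [subspaceExp, ← e.toEquiv.tprod_eq, tprod_fintype, Function.comp_apply,
    Finset.prod_subtype (t s) (p := (· ∈ span F (s : Set V))) fun v => by simp [t]]
  rfl

theorem isLinearMap_subspaceExp (hV : StronglyDiscrete V) : IsLinearMap F (subspaceExp V) := by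
  have : ContinuousConstSMul F E := ⟨fun c => by
    simpa only [Algebra.smul_def] using continuous_const_mul (algebraMap F E c)⟩
  have (s : Finset V) : Finite ((Submodule.span F (s : Set V)).map V.subtype) := by
    have := finite_span_finset (F := F) s
    exact Finite.Set.finite_image _ _
  let f (s : Finset V) : E →ₗ[F] E := IsLinearMap.mk' _
    (isLinearMap_subspaceExp_of_finite ((Submodule.span F (s : Set V)).map V.subtype))
  exact (linearMapOfTendsto (subspaceExp V) f
    (tendsto_pi_nhds.2 hV.tendsto_subspaceExp_span)).isLinear

/-- The exponential function of a strongly discrete subspace as an `F`-linear map. -/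
def exp (hV : StronglyDiscrete V) : E →ₗ[F] E := IsLinearMap.mk' _ hV.isLinearMap_subspaceExp

theorem hasProd_one_sub_div_add (hV : StronglyDiscrete V) {x : E} (hx : x ∉ V) (z : E) :
    HasProd (fun v : V => 1 - z / (x + v)) (1 - subspaceExp V z / subspaceExp V x) := by
  classical
  have hx0 : subspaceExp V x ≠ 0 := mt (hV.subspaceExp_eq_zero_iff x).1 hx
  have hexp : 1 - subspaceExp V z / subspaceExp V x = subspaceExp V (x - z) / subspaceExp V x := by
    rw [hV.isLinearMap_subspaceExp.map_sub, sub_div, div_self hx0]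
  rw [hexp, ← (Equiv.neg V).hasProd_iff]
  refine ((hV.hasProd_subspaceExp (x - z)).div₀ (hV.hasProd_subspaceExp x) hx0).congr_fun
    fun v => ?_
  have hxv : x - v ≠ 0 := sub_ne_zero.2 fun h => hx (h ▸ v.2)
  rcases eq_or_ne v 0 with rfl | hv
  · simp only [ZeroMemClass.coe_zero, sub_zero] at hxv
    simp [sub_div, hxv]
  · have : (v : E) ≠ 0 := by simpa using hv
    have : (v : E) - x ≠ 0 := by rwa [← neg_sub, neg_ne_zero]
    simp only [Function.comp_apply, Equiv.neg_apply, Submodule.coe_neg, hv, if_false,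
      ← sub_eq_add_neg]
    field_simp
    ring

theorem subspaceExp_comp (hV : StronglyDiscrete V) (hW : StronglyDiscrete W) (hVW : V ≤ W)
    (hU : StronglyDiscrete (W.map hV.exp)) (z : E) :
    subspaceExp (W.map hV.exp) (subspaceExp V z) = subspaceExp W z := by
  classical
  let g : W →ₗ[F] W.map hV.exp := hV.exp.submoduleMap W
  have hg (w : W) : (g w : E) = subspaceExp V w := rfl
  have hg0 (w : W) : g w = 0 ↔ (w : E) ∈ V := by
    rw [← Subtype.coe_inj, hg, ← hV.subspaceExp_eq_zero_iff]
    rfl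
  let fiberEquiv (x : W) : V ≃ {w : W // g w = g x} :=
    { toFun v := ⟨x + Submodule.inclusion hVW v, by
        rw [map_add, add_eq_left, hg0]
        exact v.2⟩
      invFun w := ⟨w - x, (hg0 (w - x)).1 (by rw [map_sub, w.2, sub_self])⟩
      left_inv v := by simp
      right_inv w := by ext; simp }
  refine (hU.hasProd_subspaceExp _).unique
    (((Equiv.sigmaFiberEquiv g).hasProd_iff.2 (hW.hasProd_subspaceExp z)).sigma fun u => ?_)
  rcases eq_or_ne u 0 with rfl | hu
  · rw [if_pos rfl, ← map_zero g, ← (fiberEquiv 0).hasProd_iff]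
    refine (hV.hasProd_subspaceExp z).congr_fun fun v => ?_
    change (if 0 + Submodule.inclusion hVW v = 0 then z
      else 1 - z / ((0 + Submodule.inclusion hVW v : W) : E)) = _
    simp only [zero_add, map_eq_zero_iff _ (Submodule.inclusion_injective hVW),
      Submodule.coe_inclusion]
  · obtain ⟨x, rfl⟩ := hV.exp.submoduleMap_surjective W u
    have hx : (x : E) ∉ V := mt (hg0 x).2 hu
    rw [if_neg hu, ← (fiberEquiv x).hasProd_iff]
    refine (hV.hasProd_one_sub_div_add hx z).congr_fun fun v => ?_
    have hxv : x + Submodule.inclusion hVW v ≠ 0 := fun h =>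
      hx (eq_neg_of_add_eq_zero_left (congrArg Subtype.val h) ▸ neg_mem v.2)
    exact if_neg hxv

end StronglyDiscrete

end SubspaceExp

section Polynomials

variable {F : Type*} [Field F]

theorem card_quotient_smul_top {R : Type*} [CommRing R] (M : Type*) [AddCommGroup M] [Module R M]
    [Module.Free R M] [Module.Finite R M] (I : Ideal R) :
    Nat.card (M ⧸ (I • ⊤ : Submodule R M)) = Nat.card (R ⧸ I) ^ Module.finrank R M := by
  rw [← Nat.card_congr (TensorProduct.quotTensorEquivQuotSMul M I).toEquiv]
  rcases subsingleton_or_nontrivial (R ⧸ I) with h | h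
  · have := Module.subsingleton (R ⧸ I) (TensorProduct R (R ⧸ I) M)
    simp
  · have := (Ideal.Quotient.mk I).domain_nontrivial
    rw [Nat.card_congr (Module.finBasis (R ⧸ I) _).equivFun.toEquiv, Nat.card_fun, Nat.card_fin,
      Module.finrank_baseChange]

theorem card_quotient_span_singleton {a : F[X]} (ha : a ≠ 0) :
    Nat.card (F[X] ⧸ Ideal.span {a}) = Nat.card F ^ a.natDegree := by
  have : Module.Finite F (F[X] ⧸ Ideal.span {a}) := (AdjoinRoot.powerBasis ha).finite
  rw [Module.natCard_eq_pow_finrank (K := F), finrank_quotient_span_eq_natDegree]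

variable [Fintype F]

theorem CInf.T_ne_zero : CInf.T F ≠ 0 := by
  rw [← norm_pos_iff, CInf.norm_T]
  exact_mod_cast Fintype.card_pos

theorem algebraMap_X_eq_T : algebraMap F[X] (CInf F) X = CInf.T F := by
  rw [← mul_one (CInf.T F), ← CInf.X_smul, Algebra.smul_def, mul_one]

theorem norm_algebraMap_constant {c : F} (hc : c ≠ 0) : ‖algebraMap F (CInf F) c‖ = 1 :=
  (((algebraMap F (CInf F) : F →* CInf F).comp (Units.coeHom F)).isOfFinOrder
    (isOfFinOrder_of_finite (Units.mk0 c hc))).norm_eq_one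

theorem norm_algebraMap_polynomial {a : F[X]} (ha : a ≠ 0) :
    ‖algebraMap F[X] (CInf F) a‖ = (Fintype.card F : ℝ) ^ a.natDegree := by
  have hq : (1 : ℝ) < Fintype.card F := by exact_mod_cast Fintype.one_lt_card
  have hC {c : F} (hc : c ≠ 0) : ‖algebraMap F[X] (CInf F) (C c)‖ = 1 := by
    rw [← Polynomial.algebraMap_eq, ← IsScalarTower.algebraMap_apply, norm_algebraMap_constant hc]
  induction h : a.natDegree generalizing a with
  | zero =>
    rw [eq_C_of_natDegree_eq_zero h] at ha ⊢
    rw [hC (by simpa using ha), pow_zero]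
  | succ n ih =>
    have hd : a.divX.natDegree = n := by rw [natDegree_divX_eq_natDegree_tsub_one, h]; rfl
    have hd0 : a.divX ≠ 0 := fun h0 => by
      rw [divX_eq_zero_iff.1 h0, natDegree_C] at h
      omega
    have hX : ‖algebraMap F[X] (CInf F) (X * a.divX)‖ = (Fintype.card F : ℝ) ^ (n + 1) := by
      rw [map_mul, norm_mul, algebraMap_X_eq_T, CInf.norm_T, ih hd0 hd, pow_succ']
    have hlt : ‖algebraMap F[X] (CInf F) (C (a.coeff 0))‖ <
        ‖algebraMap F[X] (CInf F) (X * a.divX)‖ := by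
      rw [hX]
      rcases eq_or_ne (a.coeff 0) 0 with h0 | h0
      · rw [h0, C_0, map_zero, norm_zero]
        positivity
      · exact (hC h0).trans_lt (one_lt_pow₀ hq n.succ_ne_zero)
    rw [← hX, ← max_eq_left hlt.le, ← IsUltrametricDist.norm_add_eq_max_of_norm_ne_norm hlt.ne',
      ← map_add, X_mul_divX_add]

theorem algebraMap_polynomial_ne_zero {a : F[X]} (ha : a ≠ 0) :
    algebraMap F[X] (CInf F) a ≠ 0 := by
  rw [← norm_ne_zero_iff, norm_algebraMap_polynomial ha]
  positivity

end Polynomials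

section Lattice

variable {F : Type*} [Field F] [Fintype F] {Λ : Submodule F[X] (CInf F)}

theorem latticeExp_eq_subspaceExp (Λ : Submodule F[X] (CInf F)) :
    latticeExp Λ = subspaceExp (Λ.restrictScalars F) := by
  ext z
  let i (l : {l : CInf F // l ∈ Λ ∧ l ≠ 0}) : Λ.restrictScalars F := ⟨l, l.2.1⟩
  have hi : Function.Injective i := fun l l' h => Subtype.ext (congrArg (·.1) h)
  rw [latticeExp, subspaceExp, ← hi.tprod_eq]
  intro l hl
  exact ⟨⟨l, l.2, fun h => hl (by simp [h])⟩, rfl⟩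

theorem IsLattice.stronglyDiscrete {r : ℕ} (hΛ : IsLattice r Λ) :
    StronglyDiscrete (Λ.restrictScalars F) :=
  stronglyDiscrete_iff.2 hΛ.discrete

/-- The image of `a⁻¹ Λ` under the exponential function of `Λ`. If `Λ` is the period lattice of a
Drinfeld module `φ`, then this is the space `φ[a]` of `a`-division points. -/
def divisionSpace (hΛ : StronglyDiscrete (Λ.restrictScalars F)) (a : F[X]) :
    Submodule F (CInf F) :=
  ((Λ.restrictScalars F).comap (LinearMap.mulLeft F (algebraMap F[X] (CInf F) a))).map hΛ.exp

theorem mem_divisionSpace {hΛ : StronglyDiscrete (Λ.restrictScalars F)} {a : F[X]} {u : CInf F} :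
    u ∈ divisionSpace hΛ a ↔ ∃ z, a • z ∈ Λ ∧ subspaceExp (Λ.restrictScalars F) z = u := by
  simp only [Algebra.smul_def]
  rfl

theorem card_divisionSpace [Module.Free F[X] Λ] [Module.Finite F[X] Λ]
    (hΛ : StronglyDiscrete (Λ.restrictScalars F)) {a : F[X]} (ha : a ≠ 0) :
    Nat.card (divisionSpace hΛ a) = Nat.card F ^ (a.natDegree * Module.finrank F[X] Λ) := by
  let c := algebraMap F[X] (CInf F) a
  have hc : c ≠ 0 := algebraMap_polynomial_ne_zero ha
  have hdiv (z : CInf F) : c⁻¹ * (a • z) = z := by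
    rw [Algebra.smul_def, inv_mul_cancel_left₀ hc]
  have hmul (z : CInf F) : a • (c⁻¹ * z) = z := by
    rw [Algebra.smul_def, mul_inv_cancel_left₀ hc]
  let f : Λ →ₗ[F] CInf F :=
    hΛ.exp ∘ₗ LinearMap.mulLeft F c⁻¹ ∘ₗ Λ.subtype.restrictScalars F
  have hrange : LinearMap.range f = divisionSpace hΛ a := by
    ext u
    rw [mem_divisionSpace]
    refine ⟨?_, fun ⟨z, hz, hu⟩ => ⟨⟨a • z, hz⟩, ?_⟩⟩
    · rintro ⟨l, rfl⟩
      exact ⟨c⁻¹ * l, (hmul l).symm ▸ l.2, rfl⟩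
    · exact (congrArg hΛ.exp (hdiv z)).trans hu
  have hker : LinearMap.ker f = (Ideal.span {a} • ⊤ : Submodule F[X] Λ).restrictScalars F := by
    ext l
    rw [Submodule.restrictScalars_mem, Submodule.ideal_span_singleton_smul,
      Submodule.mem_smul_pointwise_iff_exists, LinearMap.mem_ker]
    refine (hΛ.subspaceExp_eq_zero_iff (c⁻¹ * l)).trans ⟨fun h => ⟨⟨_, h⟩, trivial, ?_⟩, ?_⟩
    · exact Subtype.ext (hmul l)
    · rintro ⟨l, -, rfl⟩
      exact (hdiv l).symm ▸ l.2
  rw [← hrange, ← Nat.card_congr f.quotKerEquivRange.toEquiv, hker,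
    Nat.card_congr (Submodule.Quotient.restrictScalarsEquiv F _).toEquiv,
    card_quotient_smul_top, card_quotient_span_singleton ha, pow_mul]

theorem finite_divisionSpace [Module.Free F[X] Λ] [Module.Finite F[X] Λ]
    (hΛ : StronglyDiscrete (Λ.restrictScalars F)) {a : F[X]} (ha : a ≠ 0) :
    Finite (divisionSpace hΛ a) :=
  (Nat.card_pos_iff.1 (card_divisionSpace hΛ ha ▸ pow_pos Nat.card_pos _)).2

theorem subspaceExp_polynomial_smul [Module.Free F[X] Λ] [Module.Finite F[X] Λ]
    (hΛ : StronglyDiscrete (Λ.restrictScalars F)) {a : F[X]} (ha : a ≠ 0) (z : CInf F) :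
    subspaceExp (Λ.restrictScalars F) (a • z) =
      a • subspaceExp (divisionSpace hΛ a) (subspaceExp (Λ.restrictScalars F) z) := by
  have hc := algebraMap_polynomial_ne_zero ha
  have := finite_divisionSpace hΛ ha
  have hle : Λ.restrictScalars F ≤
      (Λ.restrictScalars F).comap (LinearMap.mulLeft F (algebraMap F[X] (CInf F) a)) :=
    fun l hl => by
      simpa [Algebra.smul_def] using Λ.smul_mem a hl
  rw [divisionSpace, hΛ.subspaceExp_comp (hΛ.comap_mulLeft hc) hle
    (stronglyDiscrete_of_finite (divisionSpace hΛ a)), subspaceExp_comap_mulLeft _ hc,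
    Algebra.smul_def, Algebra.smul_def, mul_inv_cancel_left₀ hc]

end Lattice

section ClosedSubfields

theorem mem_of_dist_map_le {E : Type*} [PseudoMetricSpace E] {M : Set E} (hM : IsClosed M)
    {g : E → E} (hg : Set.MapsTo g M M) {x u : E} (hu : u ∈ M) {c : ℝ} (hc0 : 0 ≤ c) (hc : c < 1)
    (h : ∀ v, dist v x ≤ dist u x → dist (g v) x ≤ c * dist v x) : x ∈ M := by
  have hdist (n : ℕ) : dist (g^[n] u) x ≤ c ^ n * dist u x := by
    induction n with
    | zero => simp
    | succ n ih =>
      have hle := ih.trans (mul_le_of_le_one_left dist_nonneg (pow_le_one₀ hc0 hc.le))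
      rw [Function.iterate_succ_apply', pow_succ', mul_assoc]
      exact (h _ hle).trans (mul_le_mul_of_nonneg_left ih hc0)
  have hlim : Tendsto (fun n => g^[n] u) atTop (𝓝 x) := by
    rw [tendsto_iff_dist_tendsto_zero]
    refine squeeze_zero (fun _ => dist_nonneg) hdist ?_
    simpa using (tendsto_pow_atTop_nhds_zero_of_lt_one hc0 hc).mul_const (dist u x)
  exact hM.mem_of_tendsto hlim (.of_forall fun n => hg.iterate n hu)

/-- Newton's iteration `v ↦ v + c⁻¹ (f x - f v)` for the equation `f v = f x` stays in `M` and
converges to `x`. -/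
theorem eventually_mem_of_map_mem {E : Type*} [NontriviallyNormedField E] {f : E →+ E} {c : E}
    (hf : HasDerivAt f c 0) (hc : c ≠ 0) :
    ∀ᶠ x in 𝓝 0, ∀ M : Subfield E, IsClosed (M : Set E) → c ∈ M → (∀ z ∈ M, f z ∈ M) →
      f x ∈ M → x ∈ M := by
  have hsmall : ∀ᶠ d in 𝓝 0, ‖f d - c * d‖ ≤ ‖c‖ / 2 * ‖d‖ := by
    simpa [mul_comm c] using (hasDerivAt_iff_isLittleO.1 hf).def (half_pos (norm_pos_iff.2 hc))
  obtain ⟨ρ, hρ, hball⟩ := Metric.eventually_nhds_iff.1 hsmall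
  filter_upwards [Metric.ball_mem_nhds 0 hρ] with x hx M hM hcM hfM hfx
  refine mem_of_dist_map_le hM (g := fun v => v + c⁻¹ * (f x - f v)) (u := 0) (c := 1 / 2)
    (fun v hv => add_mem hv (mul_mem (inv_mem hcM) (sub_mem hfx (hfM v hv)))) M.zero_mem
    (by norm_num) (by norm_num) fun v hv => ?_
  have hd : ‖f (v - x) - c * (v - x)‖ ≤ ‖c‖ / 2 * ‖v - x‖ := by
    refine hball ?_
    rw [dist_zero_right, ← dist_eq_norm]
    exact hv.trans_lt (by rwa [dist_comm])
  have hg : v + c⁻¹ * (f x - f v) - x = -(c⁻¹ * (f (v - x) - c * (v - x))) := by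
    rw [map_sub, mul_sub c⁻¹ (f v - f x), inv_mul_cancel_left₀ hc]
    ring
  rw [dist_eq_norm, dist_eq_norm, hg, norm_neg, norm_mul, norm_inv]
  refine (mul_le_mul_of_nonneg_left hd (by positivity)).trans_eq ?_
  field_simp

theorem isClosed_of_finiteDimensional {k E : Type*} [NontriviallyNormedField k] [CompleteSpace k]
    [NormedField E] [Algebra k E] [ContinuousSMul k E] (M : IntermediateField k E)
    [FiniteDimensional k M] : IsClosed (M : Set E) :=
  Submodule.closed_of_finiteDimensional (Subalgebra.toSubmodule M.toSubalgebra)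

theorem StronglyDiscrete.subspaceExp_mem {F E : Type*} [Field F] [NormedField E]
    [IsUltrametricDist E] [CompleteSpace E] [Algebra F E] {V : Submodule F E}
    (hV : StronglyDiscrete V) {M : Subfield E} (hM : IsClosed (M : Set E)) (hVM : (V : Set E) ⊆ M)
    {z : E} (hz : z ∈ M) : subspaceExp V z ∈ M := by
  refine mul_mem hz (hM.mem_of_tendsto (hV.multipliable_one_sub_div z).hasProd (.of_forall ?_))
  exact fun s => prod_mem fun v _ => sub_mem (one_mem M) (div_mem hz (hVM v.2))

theorem infinite_range_subspaceExp {F : Type*} [Field F] {E : Type*} [NontriviallyNormedField E]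
    [IsUltrametricDist E] [CompleteSpace E] [Algebra F E] {V : Submodule F E}
    (hV : StronglyDiscrete V) : (Set.range (subspaceExp V)).Infinite := by
  intro hfin
  have hne := hfin.eventually_all.2 fun c _ =>
    (hasDerivAt_subspaceExp hV).eventually_ne one_ne_zero (c := c)
  obtain ⟨z, hz⟩ := hne.exists
  exact hz _ ⟨z, rfl⟩ rfl

end ClosedSubfields

section Torsion

variable {F : Type*} [Field F] [Fintype F]

theorem algebraMap_polynomial_mem {L : IntermediateField (KInf F) (CInf F)}
    (M : IntermediateField L (CInf F)) (a : F[X]) : algebraMap F[X] (CInf F) a ∈ M := by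
  rw [IsScalarTower.algebraMap_apply F[X] (KInf F) (CInf F)]
  exact M.algebraMap_mem (algebraMap (KInf F) L (algebraMap F[X] (KInf F) a))

theorem polynomial_smul_mem {L : IntermediateField (KInf F) (CInf F)}
    (M : IntermediateField L (CInf F)) (a : F[X]) {z : CInf F} (hz : z ∈ M) : a • z ∈ M := by
  rw [Algebra.smul_def]
  exact mul_mem (algebraMap_polynomial_mem M a) hz

variable {L : IntermediateField (KInf F) (CInf F)} {r : ℕ} {φ : DrinfeldModule L r}

namespace DrinfeldModule

theorem hasDerivAt_opT (φ : DrinfeldModule L r) : HasDerivAt φ.opT (CInf.T F) 0 := by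
  have hsum := HasDerivAt.fun_sum (u := Finset.univ) fun (i : Fin (r + 1)) _ =>
    (hasDerivAt_pow (Fintype.card F ^ (i : ℕ)) (0 : CInf F)).const_mul (φ.coeff i : CInf F)
  refine hsum.congr_deriv ?_
  have hpow (n : ℕ) : Fintype.card F ^ (n + 1) - 1 ≠ 0 :=
    (Nat.sub_pos_of_lt (Nat.one_lt_pow n.succ_ne_zero Fintype.one_lt_card)).ne'
  simp only [Fin.sum_univ_succ, Fin.val_zero, Fin.val_succ, pow_zero, Nat.cast_one, tsub_self,
    mul_one, zero_pow (hpow _), mul_zero, Finset.sum_const_zero, add_zero, φ.coeff_zero]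
  rfl

theorem opT_mem (φ : DrinfeldModule L r) (M : IntermediateField L (CInf F)) {z : CInf F}
    (hz : z ∈ M) : φ.opT z ∈ M := by
  change ∑ i : Fin (r + 1), algebraMap L (CInf F) (φ.coeff i) * z ^ Fintype.card F ^ (i : ℕ) ∈ M
  exact sum_mem fun i _ => mul_mem (M.algebraMap_mem (φ.coeff i)) (pow_mem hz _)

theorem exists_polynomial_op (φ : DrinfeldModule L r) (a : F[X]) :
    ∃ P : L[X], ∀ z, φ.op a z = aeval z P := by
  induction a using Polynomial.induction_on with
  | C c =>
    refine ⟨C (algebraMap F L c) * X, fun z => ?_⟩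
    rw [op, aeval_C, Module.algebraMap_end_apply, map_mul, aeval_C, aeval_X, Algebra.smul_def]
    rfl
  | add a b ha hb =>
    obtain ⟨P, hP⟩ := ha
    obtain ⟨Q, hQ⟩ := hb
    exact ⟨P + Q, fun z => by rw [map_add, map_add, LinearMap.add_apply, hP, hQ]⟩
  | monomial n c ih =>
    obtain ⟨P, hP⟩ := ih
    refine ⟨P.comp (∑ i : Fin (r + 1), C (φ.coeff i) * X ^ Fintype.card F ^ (i : ℕ)), fun z => ?_⟩
    have hT : φ.op X z =
        aeval z (∑ i : Fin (r + 1), C (φ.coeff i) * X ^ Fintype.card F ^ (i : ℕ)) := by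
      rw [op, aeval_X]
      simp only [map_sum, map_mul, aeval_C, map_pow, aeval_X]
      rfl
    rw [pow_succ, ← mul_assoc, map_mul, Module.End.mul_apply, hP, hT, aeval_comp]

end DrinfeldModule

namespace IsPeriodLattice

variable {Λ : Submodule F[X] (CInf F)}

theorem op_subspaceExp (h : IsPeriodLattice φ Λ) (a : F[X]) (z : CInf F) :
    φ.op a (subspaceExp (Λ.restrictScalars F) z) = subspaceExp (Λ.restrictScalars F) (a • z) := by
  let e := h.isLattice.stronglyDiscrete.exp
  change φ.op a (e z) = e (a • z)
  have hX (z : CInf F) : φ.op X (e z) = e ((X : F[X]) • z) := by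
    have hT := h.latticeExp_T_mul z
    rw [latticeExp_eq_subspaceExp] at hT
    rw [DrinfeldModule.op, aeval_X, CInf.X_smul]
    exact hT.symm
  induction a using Polynomial.induction_on generalizing z with
  | C c =>
    rw [DrinfeldModule.op, aeval_C, Module.algebraMap_end_apply, ← Polynomial.algebraMap_eq,
      algebraMap_smul, map_smul]
  | add a b ha hb => rw [map_add, LinearMap.add_apply, ha, hb, ← map_add, ← add_smul]
  | monomial n c ih =>
    rw [pow_succ, ← mul_assoc, map_mul, Module.End.mul_apply, hX, ih, mul_smul _ X]

theorem op_eq (h : IsPeriodLattice φ Λ) {a : F[X]} (ha : a ≠ 0) (z : CInf F) :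
    φ.op a z = a • subspaceExp (divisionSpace h.isLattice.stronglyDiscrete a) z := by
  have := h.isLattice.free
  have := h.isLattice.finite
  have hΛ := h.isLattice.stronglyDiscrete
  have := finite_divisionSpace hΛ ha
  obtain ⟨P, hP⟩ := φ.exists_polynomial_op a
  obtain ⟨p, -, hp⟩ := exists_linearized_eq_subspaceExp (divisionSpace hΛ a)
  have heq : P.map (algebraMap L (CInf F)) = C (algebraMap F[X] (CInf F) a) * p := by
    refine eq_of_infinite_eval_eq _ _ ((infinite_range_subspaceExp hΛ).mono ?_)
    rintro _ ⟨z, rfl⟩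
    rw [Set.mem_ofPred_eq, eval_map_algebraMap, ← hP, h.op_subspaceExp,
      subspaceExp_polynomial_smul hΛ ha, eval_mul, eval_C, ← hp, Algebra.smul_def]
  rw [hP, ← eval_map_algebraMap, heq, eval_mul, eval_C, ← hp, Algebra.smul_def]

theorem divisionPoints_eq (h : IsPeriodLattice φ Λ) {a : F[X]} (ha : a ≠ 0) :
    φ.divisionPoints a = divisionSpace h.isLattice.stronglyDiscrete a := by
  have := h.isLattice.free
  have := h.isLattice.finite
  have := finite_divisionSpace h.isLattice.stronglyDiscrete ha
  ext z
  rw [DrinfeldModule.divisionPoints, Set.mem_ofPred_eq, h.op_eq ha, Algebra.smul_def,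
    mul_eq_zero_iff_left (algebraMap_polynomial_ne_zero ha),
    (stronglyDiscrete_of_finite _).subspaceExp_eq_zero_iff]
  rfl

theorem mem_tor_iff (h : IsPeriodLattice φ Λ) {u : CInf F} :
    u ∈ φ.tor ↔
      ∃ a : F[X], a ≠ 0 ∧ ∃ z, a • z ∈ Λ ∧ subspaceExp (Λ.restrictScalars F) z = u := by
  simp only [DrinfeldModule.tor, Set.mem_iUnion]
  refine exists_congr fun a => ⟨fun ⟨ha, hu⟩ => ⟨ha, ?_⟩, fun ⟨ha, hu⟩ => ⟨ha, ?_⟩⟩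
  · rwa [h.divisionPoints_eq ha, SetLike.mem_coe, mem_divisionSpace] at hu
  · rwa [h.divisionPoints_eq ha, SetLike.mem_coe, mem_divisionSpace]

theorem isIntegral_of_mem_tor (h : IsPeriodLattice φ Λ) {u : CInf F} (hu : u ∈ φ.tor) :
    IsIntegral L u := by
  have := h.isLattice.free
  have := h.isLattice.finite
  obtain ⟨a, ha, hu⟩ := Set.mem_iUnion₂.1 hu
  have := finite_divisionSpace h.isLattice.stronglyDiscrete ha
  obtain ⟨P, hP⟩ := φ.exists_polynomial_op a
  refine IsAlgebraic.isIntegral ⟨P, ?_, by rw [← hP]; exact hu⟩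
  rintro rfl
  have hall : φ.divisionPoints a = Set.univ := Set.eq_univ_of_forall fun z => by
    rw [DrinfeldModule.divisionPoints, Set.mem_ofPred_eq, hP, map_zero]
  rw [h.divisionPoints_eq ha] at hall
  have := NontriviallyNormedField.infinite (CInf F)
  exact Set.infinite_univ (α := CInf F) (hall ▸ Set.toFinite (divisionSpace _ a : Set (CInf F)))

end IsPeriodLattice

end Torsion

section PeriodField

theorem tendsto_pow_mul_subspaceExp_div_pow {F : Type*} [Field F] {E : Type*}
    [NontriviallyNormedField E] [IsUltrametricDist E] [CompleteSpace E] [Algebra F E]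
    {V : Submodule F E} (hV : StronglyDiscrete V) {c : E} (hc : 1 < ‖c‖) (x : E) :
    Tendsto (fun n : ℕ => c ^ n * subspaceExp V (x / c ^ n)) atTop (𝓝 x) := by
  have hlim := (hasDerivAt_subspaceExp hV).hasFDerivAt.lim x (c := fun n : ℕ => c ^ n)
    (l := atTop) (by simpa only [norm_pow] using tendsto_pow_atTop_atTop_of_one_lt hc)
  simpa [subspaceExp, div_eq_inv_mul] using hlim

theorem tendsto_div_pow_atTop_zero {E : Type*} [NormedField E] {c : E} (hc : 1 < ‖c‖) (x : E) :
    Tendsto (fun n : ℕ => x / c ^ n) atTop (𝓝 0) := by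
  have hinv : ‖c⁻¹‖ < 1 := by rw [norm_inv]; exact inv_lt_one_of_one_lt₀ hc
  simpa [div_eq_mul_inv] using (tendsto_pow_atTop_nhds_zero_of_norm_lt_one hinv).const_mul x

variable {F : Type*} [Field F] [Fintype F] {L : IntermediateField (KInf F) (CInf F)} {r : ℕ}
  {φ : DrinfeldModule L r} {Λ : Submodule F[X] (CInf F)}

theorem CInf.one_lt_norm_T : 1 < ‖CInf.T F‖ := by
  rw [CInf.norm_T]
  exact_mod_cast Fintype.one_lt_card

variable [CompleteSpace L]

theorem IsPeriodLattice.exists_mem_tor_mem_adjoin (h : IsPeriodLattice φ Λ) {l : CInf F}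
    (hl : l ∈ Λ) : ∃ x ∈ φ.tor, l ∈ IntermediateField.adjoin L {x} := by
  have hΛ := h.isLattice.stronglyDiscrete
  have hT := CInf.T_ne_zero (F := F)
  let y (n : ℕ) : CInf F := subspaceExp (Λ.restrictScalars F) (l / CInf.T F ^ n)
  have hy0 : Tendsto y atTop (𝓝 0) := by
    have hexp := (hasDerivAt_subspaceExp hΛ).continuousAt.tendsto
    rw [subspaceExp, zero_mul] at hexp
    exact hexp.comp (tendsto_div_pow_atTop_zero CInf.one_lt_norm_T l)
  have hyT (n : ℕ) : φ.opT (y (n + 1)) = y n := by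
    have hT_mul := h.latticeExp_T_mul (l / CInf.T F ^ (n + 1))
    rw [latticeExp_eq_subspaceExp] at hT_mul
    rw [← hT_mul, pow_succ', ← div_div, div_right_comm, mul_div_cancel₀ _ hT]
  have hytor (n : ℕ) : y n ∈ φ.tor := by
    refine h.mem_tor_iff.2 ⟨X ^ n, pow_ne_zero _ X_ne_zero, _, ?_, rfl⟩
    rwa [Algebra.smul_def, map_pow, algebraMap_X_eq_T, mul_div_cancel₀ _ (pow_ne_zero n hT)]
  obtain ⟨n₀, hn₀⟩ := eventually_atTop.1 (hy0.eventually
    (eventually_mem_of_map_mem (f := φ.opT.toAddMonoidHom) φ.hasDerivAt_opT hT))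
  have := IntermediateField.adjoin.finiteDimensional (h.isIntegral_of_mem_tor (hytor n₀))
  set M := IntermediateField.adjoin L {y n₀}
  have hM : IsClosed (M : Set (CInf F)) := isClosed_of_finiteDimensional M
  have hTM : CInf.T F ∈ M := algebraMap_X_eq_T (F := F) ▸ algebraMap_polynomial_mem M X
  have hyM (n : ℕ) (hn : n₀ ≤ n) : y n ∈ M := by
    induction n, hn using Nat.le_induction with
    | base => exact IntermediateField.mem_adjoin_simple_self L _
    | succ n hn ih =>
      refine hn₀ (n + 1) (by omega) M.toSubfield hM hTM (fun z => φ.opT_mem M) ?_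
      exact (hyT n).symm ▸ ih
  refine ⟨y n₀, hytor n₀, hM.mem_of_tendsto
    (tendsto_pow_mul_subspaceExp_div_pow hΛ CInf.one_lt_norm_T l) ?_⟩
  filter_upwards [eventually_ge_atTop n₀] with n hn
  exact mul_mem (pow_mem hTM n) (hyM n hn)

theorem IsPeriodLattice.finiteDimensional_adjoin (h : IsPeriodLattice φ Λ) :
    FiniteDimensional L (IntermediateField.adjoin L (Λ : Set (CInf F))) := by
  have := h.isLattice.finite
  obtain ⟨s, hs⟩ := (Module.Finite.iff_fg.1 this : Λ.FG)
  have hsΛ : (s : Set (CInf F)) ⊆ Λ := hs ▸ Submodule.subset_span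
  have heq : IntermediateField.adjoin L (Λ : Set (CInf F)) =
      IntermediateField.adjoin L (s : Set (CInf F)) := by
    let M := IntermediateField.adjoin L (s : Set (CInf F))
    let N : Submodule F[X] (CInf F) :=
      { M.toSubalgebra.toSubsemiring.toAddSubmonoid with
        smul_mem' := fun a _ hz => polynomial_smul_mem M a hz }
    have hΛN : Λ ≤ N := hs ▸ Submodule.span_le.2 (IntermediateField.subset_adjoin L _)
    exact le_antisymm (IntermediateField.adjoin_le_iff.2 hΛN)
      (IntermediateField.adjoin.mono _ _ _ hsΛ)
  rw [heq]
  refine IntermediateField.finiteDimensional_adjoin fun l hl => ?_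
  obtain ⟨x, hx, hlx⟩ := h.exists_mem_tor_mem_adjoin (hsΛ hl)
  have := IntermediateField.adjoin.finiteDimensional (h.isIntegral_of_mem_tor hx)
  exact (IsIntegral.of_finite L (⟨l, hlx⟩ : IntermediateField.adjoin L {x})).map
    (IntermediateField.val _)

theorem IsPeriodLattice.adjoin_eq_adjoin_tor (h : IsPeriodLattice φ Λ) :
    IntermediateField.adjoin L (Λ : Set (CInf F)) = IntermediateField.adjoin L φ.tor := by
  have := h.finiteDimensional_adjoin
  refine le_antisymm (IntermediateField.adjoin_le_iff.2 fun l hl => ?_)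
    (IntermediateField.adjoin_le_iff.2 fun u hu => ?_)
  · obtain ⟨x, hx, hlx⟩ := h.exists_mem_tor_mem_adjoin hl
    exact IntermediateField.adjoin.mono _ _ _ (Set.singleton_subset_iff.2 hx) hlx
  · obtain ⟨a, ha, z, hz, rfl⟩ := h.mem_tor_iff.1 hu
    let M := IntermediateField.adjoin L (Λ : Set (CInf F))
    have hΛM : (Λ : Set (CInf F)) ⊆ M := IntermediateField.subset_adjoin L _
    have hzM : z ∈ M := by
      rw [← inv_mul_cancel_left₀ (algebraMap_polynomial_ne_zero ha) z, ← Algebra.smul_def]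
      exact mul_mem (inv_mem (algebraMap_polynomial_mem M a)) (hΛM hz)
    exact h.isLattice.stronglyDiscrete.subspaceExp_mem (M := M.toSubfield)
      (isClosed_of_finiteDimensional M) hΛM hzM

end PeriodField

section Descent

theorem exists_map_eq_prod_X_sub_C_of_isGalois {K M : Type*} [Field K] [Field M] [Algebra K M]
    [FiniteDimensional K M] [IsGalois K M] (s : Finset M)
    (hs : ∀ σ : M ≃ₐ[K] M, ∀ x ∈ s, σ x ∈ s) :
    ∃ Q : K[X], Q.map (algebraMap K M) = ∏ x ∈ s, (X - C x) := by
  classical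
  rw [← mem_lifts, lifts_iff_coeff_lifts]
  intro n
  rw [IsGalois.mem_range_algebraMap_iff_fixed]
  intro σ
  have himage : s.image σ = s := Finset.eq_of_subset_of_card_le
    (Finset.image_subset_iff.2 (hs σ)) (Finset.card_image_of_injective s σ.injective).ge
  have hmap : (∏ x ∈ s, (X - C x)).map (σ : M →+* M) = ∏ x ∈ s, (X - C x) := by
    conv_rhs => rw [← himage, Finset.prod_image σ.injective.injOn]
    simp [Polynomial.map_prod]
  conv_rhs => rw [← hmap, coeff_map]
  rfl

theorem exists_subspaceExp_eq_aeval_of_isGalois {F K E : Type*} [Field F] [Fintype F] [Field K]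
    [NontriviallyNormedField E] [IsUltrametricDist E] [CompleteSpace E] [Algebra F E] [Algebra K E]
    (U : Submodule F E) [Finite U] (M : IntermediateField K E) [FiniteDimensional K M]
    [IsGalois K M] (hUM : (U : Set E) ⊆ M)
    (hσ : ∀ (σ : M ≃ₐ[K] M) (x : M), (x : E) ∈ U → (σ x : E) ∈ U) :
    ∃ p : K[X], p.map (algebraMap K E) ∈ linearized (Fintype.card F) E ∧
      p.natDegree = Nat.card U ∧ p.coeff 1 = 1 ∧ ∀ z, subspaceExp U z = aeval z p := by
  classical
  cases nonempty_fintype U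
  let i (u : U) : M := ⟨u, hUM u.2⟩
  have hi : Function.Injective i := fun u v h => Subtype.ext (congrArg (fun x : M => (x : E)) h)
  obtain ⟨Q, hQ⟩ := exists_map_eq_prod_X_sub_C_of_isGalois (K := K) (Finset.univ.image i)
    fun σ x hx => by
      obtain ⟨u, -, rfl⟩ := Finset.mem_image.1 hx
      exact Finset.mem_image.2 ⟨⟨_, hσ σ (i u) u.2⟩, Finset.mem_univ _, rfl⟩
  have hQE : Q.map (algebraMap K E) = ∏ u : U, (X - C (u : E)) := by
    rw [IsScalarTower.algebraMap_eq K M E, ← Polynomial.map_map, hQ,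
      Finset.prod_image hi.injOn, Polynomial.map_prod]
    simp [i]
  obtain ⟨a, ha⟩ := exists_subspaceExp_eq_mul_eval_prod_X_sub_C U
  have ha1 : a * algebraMap K E (Q.coeff 1) = 1 := by
    have hderiv : HasDerivAt (subspaceExp U)
        (a * (Q.map (algebraMap K E)).derivative.eval 0) 0 := by
      rw [funext ha, ← hQE]
      exact ((Q.map (algebraMap K E)).hasDerivAt 0).const_mul a
    have := hderiv.unique (hasDerivAt_subspaceExp (stronglyDiscrete_of_finite U))
    simpa only [← coeff_zero_eq_eval_zero, coeff_derivative, coeff_map, zero_add, Nat.cast_zero,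
      mul_one] using this
  have hQ1 : Q.coeff 1 ≠ 0 := fun h => by simp [h] at ha1
  have hac : algebraMap K E (Q.coeff 1)⁻¹ = a := by
    rw [map_inv₀]
    exact inv_eq_of_mul_eq_one_left ha1
  refine ⟨C (Q.coeff 1)⁻¹ * Q, ?_, ?_, ?_, fun z => ?_⟩
  · rw [Polynomial.map_mul, map_C, hQE, ← smul_eq_C_mul]
    exact Submodule.smul_mem _ _ (prod_X_sub_C_mem_linearized U)
  · rw [natDegree_C_mul (inv_ne_zero hQ1), ← natDegree_map (algebraMap K E), hQE,
      natDegree_finsetProd_X_sub_C_eq_card, Finset.card_univ, Nat.card_eq_fintype_card]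
  · rw [coeff_C_mul, inv_mul_cancel₀ hQ1]
  · rw [ha, map_mul, aeval_C, hac, ← hQE, eval_map_algebraMap]

theorem coe_algEquiv_subspaceExp {F K E : Type*} [Field F] [NontriviallyNormedField K]
    [CompleteSpace K] [NormedField E] [IsUltrametricDist E] [Algebra F K]
    [Algebra F E] [Algebra K E] [IsScalarTower F K E] [ContinuousSMul K E]
    (M : IntermediateField K E) [FiniteDimensional K M] {V : Submodule F E}
    (hV : StronglyDiscrete V) (hVM : (V : Set E) ⊆ M)
    (hσ : ∀ (σ : M ≃ₐ[K] M) (x : M), (x : E) ∈ V → (σ x : E) ∈ V)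
    (σ : M ≃ₐ[K] M) {x y : M} (hxy : (x : E) = subspaceExp V y) :
    (σ x : E) = subspaceExp V (σ y) := by
  have : CompleteSpace M := FiniteDimensional.complete K M
  let i : M →ₐ[F] E := M.val.restrictScalars F
  let τ : M →ₐ[F] M := (σ : M →ₐ[K] M).restrictScalars F
  have hi : Continuous i := continuous_subtype_val
  have hτ : Continuous τ := LinearMap.continuous_of_finiteDimensional (σ : M →ₗ[K] M)
  let W : Submodule F M := V.comap i.toLinearMap
  have hW : StronglyDiscrete W := stronglyDiscrete_iff.2 fun R =>
    (stronglyDiscrete_iff.1 hV R).preimage Subtype.val_injective.injOn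
  have hWi : W.map i.toLinearMap = V :=
    Submodule.map_comap_eq_self fun v hv => ⟨⟨v, hVM hv⟩, rfl⟩
  have hWτ : W.map τ.toLinearMap = W := by
    refine le_antisymm (Submodule.map_le_iff_le_comap.2 fun x => hσ σ x) fun x hx => ?_
    exact ⟨σ.symm x, hσ σ.symm x hx, σ.apply_symm_apply x⟩
  have hexp (y : M) : i (subspaceExp W y) = subspaceExp V (i y) := by
    rw [map_subspaceExp i hi W (hW.multipliable_one_sub_div y), hWi]
  have hx : x = subspaceExp W y := Subtype.ext (hxy.trans (hexp y).symm)
  change i (τ x) = subspaceExp V (i (τ y))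
  rw [hx, map_subspaceExp τ hτ W (hW.multipliable_one_sub_div y), hWτ, hexp]

variable {F : Type*} [Field F] [Fintype F] {L : IntermediateField (KInf F) (CInf F)} {r : ℕ}

theorem exists_drinfeldModule_opT_eq_T_mul_aeval {p : L[X]}
    (hp : p.map (algebraMap L (CInf F)) ∈ linearized (Fintype.card F) (CInf F))
    (hdeg : p.natDegree = Fintype.card F ^ r) (h1 : p.coeff 1 = 1) :
    ∃ φ : DrinfeldModule L r, ∀ z, φ.opT z = CInf.T F * aeval z p := by
  have hT : algebraMap (KInf F) L (KInf.T F) ≠ 0 := fun h =>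
    CInf.T_ne_zero (F := F) (congrArg (algebraMap L (CInf F)) h)
  have hp0 : p ≠ 0 := fun h => by simp [h] at h1
  refine ⟨⟨fun i => algebraMap (KInf F) L (KInf.T F) * p.coeff (Fintype.card F ^ (i : ℕ)), ?_,
    mul_ne_zero hT ?_⟩, fun z => ?_⟩
  · simp [h1]
  · rwa [Fin.val_last, ← hdeg, coeff_natDegree, leadingCoeff_ne_zero]
  · have hsum := eq_sum_of_mem_linearized Fintype.one_lt_card hp (k := r)
      (by rw [natDegree_map, hdeg])
    rw [← eval_map_algebraMap, hsum, Finset.sum_range, eval_finsetSum, Finset.mul_sum]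
    simp only [coeff_map, eval_mul, eval_C, eval_pow, eval_X, ← mul_assoc]
    rfl

/-- `φ_T` is `T` times the exponential polynomial of the finite space `e_Λ(T⁻¹Λ)`, which inherits
Galois stability from `Λ` because `e_Λ` commutes with the continuous Galois action. -/
theorem exists_isPeriodLattice_of_isGalois [CompleteSpace L]
    {Λ : Submodule F[X] (CInf F)} (hΛ : IsLattice r Λ) (M : IntermediateField L (CInf F))
    [FiniteDimensional L M] [IsGalois L M] (hΛM : (Λ : Set (CInf F)) ⊆ M)
    (hσ : ∀ (σ : M ≃ₐ[L] M) (x : M), (x : CInf F) ∈ Λ → (σ x : CInf F) ∈ Λ) :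
    ∃ φ : DrinfeldModule L r, IsPeriodLattice φ Λ := by
  have := hΛ.free
  have := hΛ.finite
  have hV := hΛ.stronglyDiscrete
  have hT := CInf.T_ne_zero (F := F)
  have hX : (X : F[X]) ≠ 0 := X_ne_zero
  have hTM : CInf.T F ∈ M := algebraMap_X_eq_T (F := F) ▸ algebraMap_polynomial_mem M X
  have : IsScalarTower F L (CInf F) := IsScalarTower.of_algebraMap_eq fun _ => rfl
  have hdivM {z : CInf F} (hz : (X : F[X]) • z ∈ Λ) : z ∈ M := by
    rw [← mul_div_cancel_left₀ z hT, ← CInf.X_smul]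
    exact div_mem (hΛM hz) hTM
  have := finite_divisionSpace hV hX
  have hUM : (divisionSpace hV X : Set (CInf F)) ⊆ M := by
    intro u hu
    obtain ⟨z, hz, rfl⟩ := mem_divisionSpace.1 hu
    exact hV.subspaceExp_mem (M := M.toSubfield) (isClosed_of_finiteDimensional M) hΛM (hdivM hz)
  have hσU (σ : M ≃ₐ[L] M) (x : M) (hx : (x : CInf F) ∈ divisionSpace hV X) :
      (σ x : CInf F) ∈ divisionSpace hV X := by
    obtain ⟨z, hz, hzx⟩ := mem_divisionSpace.1 hx
    refine mem_divisionSpace.2 ⟨σ ⟨z, hdivM hz⟩, ?_,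
      (coe_algEquiv_subspaceExp M hV hΛM hσ σ hzx.symm).symm⟩
    have hXz : (⟨_, hΛM hz⟩ : M) =
        algebraMap L M (algebraMap (KInf F) L (KInf.T F)) * ⟨z, hdivM hz⟩ :=
      Subtype.ext (CInf.X_smul F z)
    have hσXz := hσ σ ⟨_, hΛM hz⟩ hz
    rw [hXz, map_mul, AlgEquiv.commutes] at hσXz
    rw [CInf.X_smul]
    exact hσXz
  obtain ⟨p, hp, hdeg, h1, hpU⟩ :=
    exists_subspaceExp_eq_aeval_of_isGalois (divisionSpace hV X) M hUM hσU
  rw [card_divisionSpace hV hX, natDegree_X, one_mul, hΛ.finrank_eq,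
    Nat.card_eq_fintype_card] at hdeg
  obtain ⟨φ, hφ⟩ := exists_drinfeldModule_opT_eq_T_mul_aeval hp hdeg h1
  refine ⟨φ, hΛ, fun z => ?_⟩
  rw [hφ, ← hpU, latticeExp_eq_subspaceExp, ← CInf.X_smul, ← CInf.X_smul,
    subspaceExp_polynomial_smul hV hX]

end Descent

section NormIndependence

variable {R E ι : Type*} [Ring R] [SeminormedAddCommGroup E] [IsUltrametricDist E] [Module R E]

/-- Nonzero multiples of distinct members of the family `v` never have the same norm; by the
ultrametric inequality, cancellation is then impossible in linear combinations of `v`. -/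
def NormIndependent (R : Type*) {E ι : Type*} [Ring R] [SeminormedAddCommGroup E] [Module R E]
    (v : ι → E) : Prop :=
  ∀ ⦃i j : ι⦄ ⦃a b : R⦄, a • v i ≠ 0 → b • v j ≠ 0 → ‖a • v i‖ = ‖b • v j‖ → i = j

theorem NormIndependent.norm_smul_le_norm_sum {v : ι → E} (hv : NormIndependent R v)
    (s : Finset ι) (g : ι → R) {i : ι} (hi : i ∈ s) :
    ‖g i • v i‖ ≤ ‖∑ j ∈ s, g j • v j‖ := by
  classical
  rcases eq_or_ne (g i • v i) 0 with h0 | h0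
  · simp only [h0, norm_zero, norm_nonneg]
  have hp : Set.Pairwise (s.filter fun j => g j • v j ≠ 0 : Finset ι)
      fun j k => ‖g j • v j‖₊ ≠ ‖g k • v k‖₊ := fun j hj k hk hjk h =>
    hjk (hv (Finset.mem_filter.1 hj).2 (Finset.mem_filter.1 hk).2 (congrArg NNReal.toReal h))
  rw [← Finset.sum_filter_ne_zero, ← coe_nnnorm, ← coe_nnnorm, NNReal.coe_le_coe,
    IsUltrametricDist.nnnorm_sum_eq_sup_of_pairwise_ne hp]
  exact Finset.le_sup (f := fun j => ‖g j • v j‖₊) (Finset.mem_filter.2 ⟨hi, h0⟩)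

theorem NormIndependent.linearIndependent {E : Type*} [NormedAddCommGroup E]
    [IsUltrametricDist E] [Module R E] [IsDomain R] [Module.IsTorsionFree R E] {v : ι → E}
    (hv : NormIndependent R v) (h0 : ∀ i, v i ≠ 0) : LinearIndependent R v := by
  refine linearIndependent_iff'.2 fun s g hg i hi => ?_
  have hle := hv.norm_smul_le_norm_sum s g hi
  rw [hg, norm_zero, norm_le_zero_iff, smul_eq_zero] at hle
  exact hle.resolve_right (h0 i)

end NormIndependence

section ValueGroup

variable {F : Type*} [Field F] [Fintype F]

theorem mem_valueGroup {M : Subfield (CInf F)} {u : ℝˣ} :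
    u ∈ valueGroup M ↔ ∃ x ∈ M, ‖x‖ = u := by
  constructor
  · rintro ⟨x, rfl⟩
    exact ⟨x, (x : M).2, rfl⟩
  · rintro ⟨x, hx, hxu⟩
    have h0 : (⟨x, hx⟩ : M) ≠ 0 := fun h =>
      u.ne_zero (hxu ▸ norm_eq_zero.2 (congrArg Subtype.val h))
    exact ⟨Units.mk0 _ h0, Units.ext hxu⟩

theorem exists_norm_eq_norm_pow_ramificationIndex (E : Subfield (CInf F)) {M : Subfield (CInf F)}
    {x : CInf F} (hx : x ∈ M) (hx0 : x ≠ 0) :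
    ∃ y ∈ E, ‖y‖ = ‖x‖ ^ ramificationIndex E M := by
  let u : valueGroup M := ⟨Units.mk0 ‖x‖ (norm_ne_zero_iff.2 hx0), mem_valueGroup.2 ⟨x, hx, rfl⟩⟩
  exact mem_valueGroup.1 (Subgroup.pow_index_mem ((valueGroup E).subgroupOf _) u)

theorem exists_linearIndependent_quotient_valueGroup {k : Type*} [Field k] [Algebra k (CInf F)]
    (M : IntermediateField k (CInf F)) :
    ∃ x : valueGroup M.toSubfield ⧸
        (valueGroup (algebraMap k (CInf F)).fieldRange).subgroupOf (valueGroup M.toSubfield) → M,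
      LinearIndependent k x := by
  choose x hxM hx using fun t : valueGroup M.toSubfield ⧸
    (valueGroup (algebraMap k (CInf F)).fieldRange).subgroupOf (valueGroup M.toSubfield) =>
      mem_valueGroup.1 t.out.2
  have hx0 t : ‖x t‖ ≠ 0 := hx t ▸ Units.ne_zero _
  have hind : NormIndependent k x := by
    intro s t a b _ hb hab
    rw [← Quotient.out_eq' s, ← Quotient.out_eq' t]
    refine QuotientGroup.eq.2 (mem_valueGroup.2 ⟨algebraMap k (CInf F) (a / b), ⟨_, rfl⟩, ?_⟩)
    have hb0 : ‖algebraMap k (CInf F) b‖ ≠ 0 := by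
      rw [norm_ne_zero_iff]
      exact left_ne_zero_of_mul (Algebra.smul_def b (x t) ▸ hb)
    rw [Algebra.smul_def, Algebra.smul_def, norm_mul, norm_mul] at hab
    change _ = (((s.out : ℝˣ)⁻¹ * (t.out : ℝˣ) : ℝˣ) : ℝ)
    rw [map_div₀, norm_div, Units.val_mul, Units.val_inv_eq_inv_val, ← hx, ← hx, div_eq_iff hb0,
      mul_assoc, eq_inv_mul_iff_mul_eq₀ (hx0 s), mul_comm, hab, mul_comm]
  exact ⟨fun t => ⟨x t, hxM t⟩, LinearIndependent.of_comp M.val.toLinearMap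
    (hind.linearIndependent fun t => norm_ne_zero_iff.1 (hx0 t))⟩

section FiniteDimensional

variable {k : Type*} [Field k] [Algebra k (CInf F)] (M : IntermediateField k (CInf F))
  [FiniteDimensional k M]

theorem ramificationIndex_ne_zero :
    ramificationIndex (algebraMap k (CInf F)).fieldRange M.toSubfield ≠ 0 := by
  obtain ⟨x, hx⟩ := exists_linearIndependent_quotient_valueGroup M
  have := hx.finite
  exact Nat.card_ne_zero.2 ⟨⟨1⟩, this⟩

theorem ramificationIndex_le_finrank :
    ramificationIndex (algebraMap k (CInf F)).fieldRange M.toSubfield ≤ Module.finrank k M := by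
  obtain ⟨x, hx⟩ := exists_linearIndependent_quotient_valueGroup M
  have := hx.finite
  cases nonempty_fintype (valueGroup M.toSubfield ⧸
    (valueGroup (algebraMap k (CInf F)).fieldRange).subgroupOf (valueGroup M.toSubfield))
  exact (Nat.card_eq_fintype_card).trans_le hx.fintype_card_le_finrank

end FiniteDimensional

theorem fieldRange_algebraMap_eq (L : IntermediateField (KInf F) (CInf F)) :
    (algebraMap L (CInf F)).fieldRange = L.toSubfield := by
  ext x
  exact ⟨fun ⟨y, hy⟩ => hy ▸ y.2, fun hx => ⟨⟨x, hx⟩, rfl⟩⟩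

theorem KInf.exists_norm_eq_zpow {y : KInf F} (hy : y ≠ 0) :
    ∃ j : ℤ, ‖y‖ = (Fintype.card F : ℝ) ^ j := by
  refine ⟨WithZero.log (Valued.v y), ?_⟩
  rw [← KInf.norm_T, ← norm_zpow, KInf.norm_def, KInf.norm_def, map_zpow₀, KInf.valuation_T,
    ← WithZero.exp_zsmul, smul_eq_mul, mul_one, WithZero.exp_log ((Valuation.ne_zero_iff _).2 hy)]

theorem dvd_ramificationIndex_mul_of_norm_pow_eq (L : Subfield (CInf F)) {M : Subfield (CInf F)}
    {x : CInf F} (hx : x ∈ M) {d m : ℕ} (hdm : d.Coprime m) (hd : d ≠ 0)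
    (hxd : ‖x‖ ^ d = (Fintype.card F : ℝ) ^ m) :
    d ∣ ramificationIndex L M *
      ramificationIndex (algebraMap (KInf F) (CInf F)).fieldRange L := by
  have hq : (1 : ℝ) < Fintype.card F := by exact_mod_cast Fintype.one_lt_card
  have hx0 : x ≠ 0 := by
    rintro rfl
    rw [norm_zero, zero_pow hd] at hxd
    exact (pow_pos (one_pos.trans hq) m).ne hxd
  obtain ⟨y, hyL, hy⟩ := exists_norm_eq_norm_pow_ramificationIndex L hx hx0
  have hy0 : y ≠ 0 := norm_ne_zero_iff.1 (hy ▸ pow_ne_zero _ (norm_ne_zero_iff.2 hx0))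
  obtain ⟨_, ⟨z, rfl⟩, hz⟩ := exists_norm_eq_norm_pow_ramificationIndex
    (algebraMap (KInf F) (CInf F)).fieldRange hyL hy0
  have hz0 : z ≠ 0 := by
    rintro rfl
    rw [map_zero, norm_zero] at hz
    exact pow_ne_zero _ (norm_ne_zero_iff.2 hy0) hz.symm
  obtain ⟨j, hj⟩ := KInf.exists_norm_eq_zpow hz0
  rw [norm_algebraMap', hy, ← pow_mul, hj] at hz
  set e := ramificationIndex L M * ramificationIndex (algebraMap (KInf F) (CInf F)).fieldRange L
  have hpow : (Fintype.card F : ℝ) ^ (j * d) = (Fintype.card F : ℝ) ^ ((m * e : ℕ) : ℤ) := by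
    rw [zpow_mul, hz, zpow_natCast, zpow_natCast, pow_mul _ m, ← hxd, pow_right_comm]
  have hje := zpow_right_injective₀ (one_pos.trans hq) hq.ne' hpow
  exact hdm.dvd_of_dvd_mul_left (Int.natCast_dvd_natCast.1 ⟨j, by rw [← hje, mul_comm]⟩)

end ValueGroup

section TranslatedRoots

theorem isSplittingField_adjoin_simple {K E ι : Type*} [Field K] [Field E] [Algebra K E]
    [Fintype ι] {p : K[X]} {f : ι → E} (hp : p.map (algebraMap K E) = ∏ i, (X - C (f i))) (i₀ : ι)
    (hf : ∀ i, f i ∈ IntermediateField.adjoin K {f i₀}) :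
    p.IsSplittingField K (IntermediateField.adjoin K {f i₀}) := by
  have hp0 : p.map (algebraMap K E) ≠ 0 := by
    rw [hp, Finset.prod_ne_zero_iff]
    exact fun i _ => X_sub_C_ne_zero _
  have hroot {x : E} : x ∈ p.rootSet E ↔ ∃ i, x = f i := by
    rw [mem_rootSet', and_iff_right hp0, ← eval_map_algebraMap, hp, eval_prod,
      Finset.prod_eq_zero_iff]
    simp [sub_eq_zero]
  have hsub : p.rootSet E ⊆ IntermediateField.adjoin K {f i₀} := by
    intro x hx
    obtain ⟨i, rfl⟩ := hroot.1 hx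
    exact hf i
  have hsplits : (p.map (algebraMap K E)).Splits := by
    rw [hp]
    exact Splits.prod fun i _ => Splits.X_sub_C _
  refine IntermediateField.isSplittingField_iff.2
    ⟨IntermediateField.splits_of_splits hsplits hsub, le_antisymm ?_ ?_⟩
  · rw [IntermediateField.adjoin_simple_le_iff]
    exact IntermediateField.subset_adjoin K _ (hroot.2 ⟨i₀, rfl⟩)
  · exact IntermediateField.adjoin_le_iff.2 hsub

variable {F E : Type*} [Field F] [Finite F] [Field E] [Algebra F E] (U : Submodule F E) [Fintype U]

theorem prod_X_sub_C_add (x : E) :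
    ∏ u : U, (X - C (x + u)) = ∏ u : U, (X - C (u : E)) - C (∏ u : U, (x - u)) := by
  cases nonempty_fintype F
  obtain ⟨f, hf⟩ := exists_linearMap_eq_aeval_of_mem_linearized (prod_X_sub_C_mem_linearized U) E[X]
  have hprod (Y : E[X]) : f Y = ∏ u : U, (Y - C (u : E)) := by
    rw [hf, map_prod]
    simp
  have hsub := map_sub f X (C x)
  simpa only [hprod, ← C_sub, ← map_prod, sub_sub, ← C_add] using hsub

variable {U} {K : Type*} [Field K] [Algebra K E]

theorem exists_map_eq_prod_X_sub_C_add (hU : ∀ u ∈ U, u ∈ (algebraMap K E).range) {x : E}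
    (hx : ∏ u : U, (x - u) ∈ (algebraMap K E).range) :
    ∃ p : K[X], p.map (algebraMap K E) = ∏ u : U, (X - C (x + u)) := by
  rw [← mem_lifts, lifts_iff_liftsRing, prod_X_sub_C_add]
  have hC {c : E} (hc : c ∈ (algebraMap K E).range) : C c ∈ liftsRing (algebraMap K E) :=
    (lifts_iff_liftsRing _ _).1 (C'_mem_lifts hc)
  have hX : X ∈ liftsRing (algebraMap K E) := (lifts_iff_liftsRing _ _).1 (X_mem_lifts _)
  exact sub_mem (prod_mem fun u _ => sub_mem hX (hC (hU u u.2))) (hC hx)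

theorem finiteDimensional_and_isGalois_adjoin_of_prod_sub_mem
    (hU : ∀ u ∈ U, u ∈ (algebraMap K E).range) {x : E}
    (hx : ∏ u : U, (x - u) ∈ (algebraMap K E).range) :
    FiniteDimensional K (IntermediateField.adjoin K {x}) ∧
      IsGalois K (IntermediateField.adjoin K {x}) := by
  obtain ⟨p, hp⟩ := exists_map_eq_prod_X_sub_C_add hU hx
  have hsep : p.Separable := by
    rw [← separable_map (algebraMap K E), hp, separable_prod_X_sub_C_iff]
    exact fun u v h => Subtype.ext (add_left_cancel h)
  have hmem (u : U) : x + u ∈ IntermediateField.adjoin K {x + ((0 : U) : E)} := by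
    obtain ⟨c, hc⟩ := hU u u.2
    rw [Submodule.coe_zero, add_zero, ← hc]
    exact add_mem (IntermediateField.mem_adjoin_simple_self K x)
      (IntermediateField.algebraMap_mem _ c)
  have hsplit := isSplittingField_adjoin_simple hp 0 hmem
  rw [Submodule.coe_zero, add_zero] at hsplit
  exact ⟨hsplit.finiteDimensional _ p, IsGalois.of_separable_splitting_field hsep⟩

theorem exists_algEquiv_eq_add (hU : ∀ u ∈ U, u ∈ (algebraMap K E).range)
    {M : IntermediateField K E} {x : M} (hx : ∏ u : U, ((x : E) - u) ∈ (algebraMap K E).range)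
    (σ : M ≃ₐ[K] M) : ∃ u ∈ U, (σ x : E) = x + u := by
  obtain ⟨p, hp⟩ := exists_map_eq_prod_X_sub_C_add hU hx
  have hroot {y : E} : aeval y p = 0 ↔ ∃ u : U, y = x + u := by
    rw [← eval_map_algebraMap, hp, eval_prod, Finset.prod_eq_zero_iff]
    simp [sub_eq_zero]
  have hpx : aeval x p = 0 :=
    Subtype.ext ((aeval_algHom_apply M.val x p).symm.trans (hroot.2 ⟨0, by simp⟩))
  obtain ⟨u, hu⟩ := hroot.1 (show aeval (M.val.comp (σ : M →ₐ[K] M) x) p = 0 by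
    rw [aeval_algHom_apply, hpx, map_zero])
  exact ⟨u, u.2, hu⟩

end TranslatedRoots

section PowerModule

variable {A E : Type*} [CommRing A] [Field E] [Algebra A E]

variable (A) in
/-- The `A`-module generated by `1, x, …, x ^ (r - 1)`. -/
def powerModule (x : E) (r : ℕ) : Submodule A E :=
  (degreeLT A r).map (aeval x).toLinearMap

theorem mem_powerModule {x y : E} {r : ℕ} :
    y ∈ powerModule A x r ↔ ∃ p ∈ degreeLT A r, aeval x p = y :=
  Iff.rfl

theorem powerModule_eq_span (x : E) (r : ℕ) :
    powerModule A x r = Submodule.span A (Set.range fun i : Fin r => x ^ (i : ℕ)) := by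
  classical
  rw [powerModule, degreeLT_eq_span_X_pow, Submodule.map_span]
  congr 1
  ext y
  simp [Fin.exists_iff]

theorem algEquiv_mem_powerModule {K : Type*} [Field K] [Algebra A K] [Algebra K E]
    [IsScalarTower A K E] {M : IntermediateField K E} {x : M} {r : ℕ} {b : A} (σ : M ≃ₐ[K] M)
    (hx : (σ x : E) = x + algebraMap A E b) {y : M} (hy : (y : E) ∈ powerModule A (x : E) r) :
    (σ y : E) ∈ powerModule A (x : E) r := by
  obtain ⟨p, hp, hpy⟩ := mem_powerModule.1 hy
  have hpxy : aeval x p = y :=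
    Subtype.ext ((aeval_algHom_apply (M.val.restrictScalars A) x p).symm.trans hpy)
  let f : M →ₐ[A] E := (M.val.comp (σ : M →ₐ[K] M)).restrictScalars A
  refine mem_powerModule.2 ⟨taylor b p, taylor_mem_degreeLT.2 hp, ?_⟩
  change _ = f y
  rw [← hpxy, ← aeval_algHom_apply, taylor_apply, aeval_comp, aeval_add, aeval_X, aeval_C, ← hx]
  rfl

end PowerModule

section PowerLattice

variable {F : Type*} [Field F] [Fintype F] {x : CInf F} {r : ℕ}

theorem normIndependent_pow {d m : ℕ} (hrd : r ≤ d) (hdm : d.Coprime m)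
    (hx : ‖x‖ ^ d = (Fintype.card F : ℝ) ^ m) :
    NormIndependent F[X] fun i : Fin r => x ^ (i : ℕ) := by
  have hq : (1 : ℝ) < Fintype.card F := by exact_mod_cast Fintype.one_lt_card
  have hnorm {a : F[X]} {i : Fin r} (ha : a • x ^ (i : ℕ) ≠ 0) :
      ‖a • x ^ (i : ℕ)‖ ^ d = (Fintype.card F : ℝ) ^ (a.natDegree * d + m * i) := by
    have ha0 : a ≠ 0 := fun h => ha (by rw [h, zero_smul])
    rw [Algebra.smul_def, norm_mul, norm_pow, norm_algebraMap_polynomial ha0, mul_pow,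
      pow_right_comm ‖x‖, hx, ← pow_mul, ← pow_mul, ← pow_add]
  intro i j a b ha hb hab
  have hexp : a.natDegree * d + m * i = b.natDegree * d + m * j :=
    pow_right_injective₀ (one_pos.trans hq) hq.ne' (by
      change _ ^ _ = _ ^ _
      rw [← hnorm ha, ← hnorm hb, hab])
  have hmod : m * i ≡ m * j [MOD d] := by
    simpa [Nat.ModEq, Nat.add_mod] using congrArg (· % d) hexp
  exact Fin.ext ((Nat.ModEq.cancel_left_of_coprime hdm hmod).eq_of_lt_of_lt
    (i.2.trans_le hrd) (j.2.trans_le hrd))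

theorem finite_norm_le_powerModule (hx : NormIndependent F[X] fun i : Fin r => x ^ (i : ℕ))
    (hx1 : 1 ≤ ‖x‖) (R : ℝ) : {l : CInf F | l ∈ powerModule F[X] x r ∧ ‖l‖ ≤ R}.Finite := by
  have hq : (1 : ℝ) < Fintype.card F := by exact_mod_cast Fintype.one_lt_card
  obtain ⟨k, hk⟩ := pow_unbounded_of_one_lt R hq
  have : Finite (degreeLT F k) := Module.finite_of_finite F
  refine (Set.finite_range fun a : Fin r → degreeLT F k =>
    ∑ i, (a i : F[X]) • x ^ (i : ℕ)).subset ?_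
  rintro l ⟨hl, hlR⟩
  rw [powerModule_eq_span] at hl
  obtain ⟨g, rfl⟩ := (Submodule.mem_span_range_iff_exists_fun F[X]).1 hl
  have hdeg (i : Fin r) : g i ∈ degreeLT F k := by
    rcases eq_or_ne (g i) 0 with h0 | h0
    · exact h0 ▸ Submodule.zero_mem _
    have hle := (hx.norm_smul_le_norm_sum Finset.univ g (Finset.mem_univ i)).trans hlR
    rw [Algebra.smul_def, norm_mul, norm_pow, norm_algebraMap_polynomial h0] at hle
    have hlt : (Fintype.card F : ℝ) ^ (g i).natDegree < (Fintype.card F : ℝ) ^ k :=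
      (le_mul_of_one_le_right (by positivity) (one_le_pow₀ hx1)).trans_lt (hle.trans_lt hk)
    rw [mem_degreeLT, degree_eq_natDegree h0]
    exact_mod_cast (pow_lt_pow_iff_right₀ hq).1 hlt
  exact ⟨fun i => ⟨g i, hdeg i⟩, rfl⟩

variable (F) in
theorem algebraMap_polynomial_injective : Function.Injective (algebraMap F[X] (CInf F)) :=
  (injective_iff_map_eq_zero _).2 fun _ ha => by_contra fun h => algebraMap_polynomial_ne_zero h ha

theorem isLattice_powerModule (hx : NormIndependent F[X] fun i : Fin r => x ^ (i : ℕ))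
    (hx1 : 1 ≤ ‖x‖) : IsLattice r (powerModule F[X] x r) := by
  have hx0 : x ≠ 0 := norm_pos_iff.1 (one_pos.trans_le hx1)
  have := Module.isTorsionFree_iff_algebraMap_injective.2 (algebraMap_polynomial_injective F)
  have hli := hx.linearIndependent fun i => pow_ne_zero (i : ℕ) hx0
  let b := (Module.Basis.span hli).map (LinearEquiv.ofEq _ _ (powerModule_eq_span x r).symm)
  exact ⟨.of_basis b, .of_basis b, by rw [Module.finrank_eq_card_basis b, Fintype.card_fin],
    finite_norm_le_powerModule hx hx1⟩

theorem adjoin_powerModule (L : IntermediateField (KInf F) (CInf F)) (hr : 2 ≤ r) :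
    IntermediateField.adjoin L (powerModule F[X] x r : Set (CInf F)) =
      IntermediateField.adjoin L {x} := by
  rw [powerModule_eq_span]
  refine le_antisymm (IntermediateField.adjoin_le_iff.2 fun y hy => ?_)
    (IntermediateField.adjoin_simple_le_iff.2 (IntermediateField.subset_adjoin L _
      (Submodule.subset_span ⟨⟨1, hr⟩, pow_one x⟩)))
  obtain ⟨g, rfl⟩ := (Submodule.mem_span_range_iff_exists_fun F[X]).1 hy
  exact sum_mem fun i _ => polynomial_smul_mem _ _
    (pow_mem (IntermediateField.mem_adjoin_simple_self L x) _)

end PowerLattice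

section WildExtension

theorem lt_norm_and_norm_pow_card_eq {ι E : Type*} [Fintype ι] [NormedField E]
    [IsUltrametricDist E] {f : ι → E} {x : E} {R : ℝ} (hf : ∀ i, ‖f i‖ ≤ R)
    (h : R ^ Fintype.card ι < ‖∏ i, (x - f i)‖) :
    R < ‖x‖ ∧ ‖x‖ ^ Fintype.card ι = ‖∏ i, (x - f i)‖ := by
  rw [norm_prod] at h ⊢
  have hlt : R < ‖x‖ := by
    contrapose! h
    rw [← Finset.card_univ, ← Finset.prod_const]
    refine Finset.prod_le_prod (fun _ _ => norm_nonneg _) fun i _ => ?_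
    rw [sub_eq_add_neg]
    exact (IsUltrametricDist.norm_add_le_max x _).trans (max_le h (norm_neg (f i) ▸ hf i))
  refine ⟨hlt, ?_⟩
  have hsub (i : ι) : ‖x - f i‖ = ‖x‖ := by
    have hi := (hf i).trans_lt hlt
    rw [sub_eq_add_neg, IsUltrametricDist.norm_add_eq_max_of_norm_ne_norm
      (norm_neg (f i) ▸ hi.ne'), norm_neg, max_eq_left hi.le]
  simp only [hsub, Finset.prod_const, Finset.card_univ]

variable {F : Type*} [Field F] [Fintype F]

theorem exists_prod_sub_algebraMap_eq {ι : Type*} [Fintype ι] [Nonempty ι] (f : ι → KInf F)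
    (c : KInf F) : ∃ x : CInf F,
      ∏ i, (x - algebraMap (KInf F) (CInf F) (f i)) = algebraMap (KInf F) (CInf F) c := by
  obtain ⟨x, hx⟩ := IsAlgClosed.exists_aeval_eq_zero (KInfAlgCl F) (∏ i, (X - C (f i)) - C c) (by
    refine degree_ne_of_natDegree_ne ?_
    rw [natDegree_sub_C, natDegree_finsetProd_X_sub_C_eq_card]
    exact Fintype.card_ne_zero)
  have hx' := congrArg (algebraMap (KInfAlgCl F) (CInf F)) hx
  rw [← aeval_algebraMap_apply, map_zero, map_sub, sub_eq_zero, map_prod] at hx'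
  exact ⟨algebraMap (KInfAlgCl F) (CInf F) x, by simpa using hx'⟩

variable (F) in
/-- The space of polynomials in `T` of degree less than `n`, as a subspace of `C`. -/
def polynomialsLT (n : ℕ) : Submodule F (CInf F) :=
  (degreeLT F n).map (IsScalarTower.toAlgHom F F[X] (CInf F)).toLinearMap

theorem mem_polynomialsLT {n : ℕ} {z : CInf F} :
    z ∈ polynomialsLT F n ↔ ∃ a ∈ degreeLT F n, algebraMap F[X] (CInf F) a = z :=
  Iff.rfl

theorem card_polynomialsLT (n : ℕ) : Nat.card (polynomialsLT F n) = Fintype.card F ^ n := by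
  have hinj : Function.Injective (IsScalarTower.toAlgHom F F[X] (CInf F)).toLinearMap :=
    algebraMap_polynomial_injective F
  rw [polynomialsLT, ← Nat.card_congr (Submodule.equivMapOfInjective _ hinj _).toEquiv,
    Nat.card_congr (degreeLTEquiv F n).toEquiv, Nat.card_fun, Nat.card_eq_fintype_card,
    Nat.card_fin]

instance fintype_polynomialsLT (n : ℕ) : Fintype (polynomialsLT F n) :=
  @Fintype.ofFinite _ (Nat.finite_of_card_ne_zero
    (card_polynomialsLT (F := F) n ▸ pow_ne_zero n Fintype.card_ne_zero))

theorem norm_le_of_mem_polynomialsLT {n : ℕ} {z : CInf F} (hz : z ∈ polynomialsLT F n) :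
    ‖z‖ ≤ (Fintype.card F : ℝ) ^ n := by
  have hq : (1 : ℝ) ≤ Fintype.card F := by exact_mod_cast Fintype.card_pos
  obtain ⟨a, ha, rfl⟩ := mem_polynomialsLT.1 hz
  rcases eq_or_ne a 0 with rfl | ha0
  · rw [map_zero, norm_zero]
    positivity
  · rw [norm_algebraMap_polynomial ha0]
    rw [mem_degreeLT, degree_eq_natDegree ha0] at ha
    exact pow_le_pow_right₀ hq (by exact_mod_cast ha.le)

end WildExtension

section WildPeriods

variable {F : Type*} [Field F] [Fintype F]

theorem exists_prod_sub_polynomialsLT_eq (n : ℕ) :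
    ∃ x : CInf F, ∏ u : polynomialsLT F n, (x - u) =
      CInf.T F ^ (n * Fintype.card F ^ n + 1) := by
  choose a _ ha using fun u : polynomialsLT F n => mem_polynomialsLT.1 u.2
  obtain ⟨x, hx⟩ := exists_prod_sub_algebraMap_eq (fun u => algebraMap F[X] (KInf F) (a u))
    (KInf.T F ^ (n * Fintype.card F ^ n + 1))
  rw [map_pow] at hx
  simp only [← IsScalarTower.algebraMap_apply, ha] at hx
  exact ⟨x, hx⟩

theorem norm_of_prod_sub_polynomialsLT_eq {n : ℕ} {x : CInf F}
    (hx : ∏ u : polynomialsLT F n, (x - u) = CInf.T F ^ (n * Fintype.card F ^ n + 1)) :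
    1 ≤ ‖x‖ ∧
      ‖x‖ ^ Fintype.card F ^ n = (Fintype.card F : ℝ) ^ (n * Fintype.card F ^ n + 1) := by
  have hq : (1 : ℝ) < Fintype.card F := by exact_mod_cast Fintype.one_lt_card
  have hcard : Fintype.card (polynomialsLT F n) = Fintype.card F ^ n := by
    rw [← Nat.card_eq_fintype_card, card_polynomialsLT]
  have hnorm : ‖∏ u : polynomialsLT F n, (x - u)‖ =
      (Fintype.card F : ℝ) ^ (n * Fintype.card F ^ n + 1) := by
    rw [hx, norm_pow, CInf.norm_T]
  obtain ⟨hlt, hpow⟩ := lt_norm_and_norm_pow_card_eq (R := (Fintype.card F : ℝ) ^ n)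
    (fun u : polynomialsLT F n => norm_le_of_mem_polynomialsLT u.2) (by
      rw [hnorm, hcard, ← pow_mul]
      exact pow_lt_pow_right₀ hq (Nat.lt_succ_self _))
  exact ⟨(one_le_pow₀ hq.le).trans hlt.le, by rw [← hcard, hpow, hnorm, hcard]⟩

theorem exists_isPeriodLattice_powerModule (L : IntermediateField (KInf F) (CInf F))
    [CompleteSpace L] {n r : ℕ} (hr : 2 ≤ r) {x : CInf F}
    (hx : ∏ u : polynomialsLT F n, (x - u) ∈ L) (hΛ : IsLattice r (powerModule F[X] x r)) :
    ∃ φ : DrinfeldModule L r, IsPeriodLattice φ (powerModule F[X] x r) := by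
  have : IsScalarTower F[X] L (CInf F) := IsScalarTower.of_algebraMap_eq fun _ => rfl
  have hU (u : CInf F) (hu : u ∈ polynomialsLT F n) : u ∈ (algebraMap L (CInf F)).range := by
    obtain ⟨a, _, rfl⟩ := mem_polynomialsLT.1 hu
    exact ⟨algebraMap F[X] L a, (IsScalarTower.algebraMap_apply F[X] L (CInf F) a).symm⟩
  have hxL : ∏ u : polynomialsLT F n, (x - u) ∈ (algebraMap L (CInf F)).range := ⟨⟨_, hx⟩, rfl⟩
  obtain ⟨_, _⟩ := finiteDimensional_and_isGalois_adjoin_of_prod_sub_mem hU hxL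
  refine exists_isPeriodLattice_of_isGalois hΛ (IntermediateField.adjoin L {x}) ?_ fun σ y hy => ?_
  · rw [← adjoin_powerModule L hr]
    exact IntermediateField.subset_adjoin L _
  · let x' : IntermediateField.adjoin L {x} := ⟨x, IntermediateField.mem_adjoin_simple_self L x⟩
    obtain ⟨u, hu, hσ⟩ := exists_algEquiv_eq_add (x := x') hU hxL σ
    obtain ⟨a, _, rfl⟩ := mem_polynomialsLT.1 hu
    exact algEquiv_mem_powerModule (x := x') σ hσ hy

theorem le_ramificationIndex_of_norm_pow_eq (L : IntermediateField (KInf F) (CInf F))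
    (hL : ramificationIndex (algebraMap (KInf F) (CInf F)).fieldRange L.toSubfield ≠ 0)
    (M : IntermediateField L (CInf F)) [FiniteDimensional L M] {x : CInf F} (hx : x ∈ M)
    {d m N : ℕ} (hdm : d.Coprime m) (hxd : ‖x‖ ^ d = (Fintype.card F : ℝ) ^ m)
    (hN : N * ramificationIndex (algebraMap (KInf F) (CInf F)).fieldRange L.toSubfield ≤ d) :
    N ≤ ramificationIndex L.toSubfield M.toSubfield := by
  rcases N.eq_zero_or_pos with rfl | hN0
  · exact Nat.zero_le _
  have hd : d ≠ 0 := ((Nat.mul_pos hN0 (Nat.pos_of_ne_zero hL)).trans_le hN).ne'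
  have hM := ramificationIndex_ne_zero M
  rw [fieldRange_algebraMap_eq] at hM
  have hdvd := dvd_ramificationIndex_mul_of_norm_pow_eq L.toSubfield
    (show x ∈ M.toSubfield from hx) hdm hd hxd
  exact le_of_mul_le_mul_right (hN.trans (Nat.le_of_dvd (Nat.mul_pos (Nat.pos_of_ne_zero hM)
    (Nat.pos_of_ne_zero hL)) hdvd)) (Nat.pos_of_ne_zero hL)

theorem exists_isPeriodLattice_le_ramificationIndex (L : IntermediateField (KInf F) (CInf F))
    [CompleteSpace L] {r : ℕ} (hr : 2 ≤ r)
    (hL : ramificationIndex (algebraMap (KInf F) (CInf F)).fieldRange L.toSubfield ≠ 0) (N : ℕ) :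
    ∃ (φ : DrinfeldModule L r) (Λ : Submodule F[X] (CInf F)), IsPeriodLattice φ Λ ∧
      N ≤ ramificationIndex L.toSubfield
        (IntermediateField.adjoin L (Λ : Set (CInf F))).toSubfield := by
  set D := ramificationIndex (algebraMap (KInf F) (CInf F)).fieldRange L.toSubfield
  obtain ⟨n, hn⟩ : ∃ n, r + N * D ≤ Fintype.card F ^ n :=
    ⟨_, (Nat.lt_pow_self Fintype.one_lt_card).le⟩
  have hdm : (Fintype.card F ^ n).Coprime (n * Fintype.card F ^ n + 1) := by simp
  obtain ⟨x, hx⟩ := exists_prod_sub_polynomialsLT_eq (F := F) n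
  obtain ⟨hx1, hxd⟩ := norm_of_prod_sub_polynomialsLT_eq hx
  have hΛ := isLattice_powerModule
    (normIndependent_pow ((Nat.le_add_right _ _).trans hn) hdm hxd) hx1
  have hxL : ∏ u : polynomialsLT F n, (x - u) ∈ L :=
    hx ▸ pow_mem (L.algebraMap_mem (KInf.T F)) _
  obtain ⟨φ, hφ⟩ := exists_isPeriodLattice_powerModule L hr hxL hΛ
  refine ⟨φ, _, hφ, ?_⟩
  have := hφ.finiteDimensional_adjoin
  refine le_ramificationIndex_of_norm_pow_eq L hL _ ?_ hdm hxd
    ((Nat.le_add_left _ _).trans hn)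
  rw [adjoin_powerModule L hr]
  exact IntermediateField.mem_adjoin_simple_self L x

end WildPeriods

end DrinfeldPeriods

end

theorem theorem3_general {F : Type*} [Field F] [Fintype F]
    (L : IntermediateField (KInf F) (CInf F)) [CompleteSpace L] (r : ℕ) :
    (∀ (φ : DrinfeldModule L r) (Λ : Submodule (Polynomial F) (CInf F)), IsPeriodLattice φ Λ →
      FiniteDimensional L (IntermediateField.adjoin L (Λ : Set (CInf F))) ∧
      IntermediateField.adjoin L (Λ : Set (CInf F)) = IntermediateField.adjoin L φ.tor) ∧
    (2 ≤ r → ramificationIndex (algebraMap (KInf F) (CInf F)).fieldRange L.toSubfield ≠ 0 →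
      ∀ N : ℕ, ∃ (φ : DrinfeldModule L r) (Λ : Submodule (Polynomial F) (CInf F)),
      IsPeriodLattice φ Λ ∧
      N ≤ ramificationIndex L.toSubfield
        (IntermediateField.adjoin L (Λ : Set (CInf F))).toSubfield ∧
      N ≤ Module.finrank L (IntermediateField.adjoin L (Λ : Set (CInf F)))) := by
  refine ⟨fun φ Λ h => ⟨h.finiteDimensional_adjoin, h.adjoin_eq_adjoin_tor⟩, fun hr hL N => ?_⟩
  obtain ⟨φ, Λ, h, hN⟩ := exists_isPeriodLattice_le_ramificationIndex L hr hL N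
  have := h.finiteDimensional_adjoin
  have hle := ramificationIndex_le_finrank (IntermediateField.adjoin L (Λ : Set (CInf F)))
  rw [fieldRange_algebraMap_eq] at hle
  exact ⟨φ, Λ, h, hN, hN.trans hle⟩

theorem theorem3 {F : Type*} [Field F] [Fintype F]
    (L : IntermediateField (KInf F) (CInf F)) [FiniteDimensional (KInf F) L]
    (r : ℕ) (hr : 2 ≤ r) :
    (∀ (φ : DrinfeldModule L r) (Λ : Submodule (Polynomial F) (CInf F)), IsPeriodLattice φ Λ →
      FiniteDimensional L (IntermediateField.adjoin L (Λ : Set (CInf F))) ∧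
      IntermediateField.adjoin L (Λ : Set (CInf F)) = IntermediateField.adjoin L φ.tor) ∧
    ∀ N : ℕ, ∃ (φ : DrinfeldModule L r) (Λ : Submodule (Polynomial F) (CInf F)),
      IsPeriodLattice φ Λ ∧
      N ≤ ramificationIndex L.toSubfield
        (IntermediateField.adjoin L (Λ : Set (CInf F))).toSubfield ∧
      N ≤ Module.finrank L (IntermediateField.adjoin L (Λ : Set (CInf F))) := by
  have := FiniteDimensional.complete (KInf F) L
  exact (theorem3_general L r).imp id fun h => h hr (ramificationIndex_ne_zero L)
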